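/- **Theorem.** Let $X$ be a complex manifold of complex dimension $2n$ with complex structure operator $I$, and let $\Omega$ be a holomorphically symplectic form on $X$, i.e. a smooth closed complex-valued $2$-form of Hodge type $(2,0)$ that is non-degenerate at every point of $X$ ($\Omega_x(u,\cdot)=0$ only for $u=0$). Let $B$ be a complex manifold and $\pi\colon X\to B$ a Lagrangian fibration: a holomorphic map all of whose fibers are Lagrangian. Fibers may be singular or multiple; a fiber is called Lagrangian (with respect to a complex-valued $2$-form) if its tangent space at each of its regular points (the points near which the fiber, as a set, is a smooth submanifold) is a maximal isotropic real subspace. Let $\eta$ be a smooth closed complex-valued $2$-form on $B$ of Hodge type $(2,0)+(1,1)$, let $t\in\mathbb C$, and put $\Omega_t=\Omega+t\,\pi^*\eta$. Then: 1. $\Omega_t$ is c-symplectic: it is smooth and closed, $(\Omega_t\wedge\overline{\Omega_t})^{n}$ is nowhere zero, and $\Omega_t^{\,n+1}=0$. 2. There is a unique almost complex structure $I_t$ on $X$ such that $\Omega_t$ is a non-degenerate form of type $(2,0)$ with respect to $I_t$. It is smooth, and it is integrable in the sense that its Nijenhuis tensor vanishes. 3. The deformation $(X,I_t,\Omega_t)$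 (the *degenerate twistorial deformation*) preserves the Lagrangian fibration and the base: $\pi$ is holomorphic as a map from $(X,I_t)$ to $B$ with its original complex structure, i.e. $d\pi\circ I_t=I_B\circ d\pi$, and all its fibers are Lagrangian with respect to $\Omega_t$. 4. The complex structure of the fibers is unchanged: the tangent space of a fiber at each of its regular points is preserved by $I_t$, and $I_t=I$ on it; moreover, $I_t=I$ on $\ker d_x\pi$ for every $x\in X$. -/

import Mathlib

open scoped Manifold ContDiff

noncomputable section

namespace CSymp

/-! ### Linear algebra of complex-valued 2-forms on a real vector space -/

section Linear

variable {V : Type*} [AddCommGroup V] [Module ℝ V] [TopologicalSpace V]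

/-- The conjugate of a complex-valued real 2-form. -/
def conjForm (α : V [⋀^Fin 2]→L[ℝ] ℂ) : V [⋀^Fin 2]→L[ℝ] ℂ :=
  (Complex.conjCLE : ℂ →L[ℝ] ℂ).compContinuousAlternatingMap α

/-- The wedge product `⋀_{i ∈ κ} α i` of a finite family of complex-valued 2-forms (2-forms commute,
so no order on `κ` is needed), evaluated at a family of `2 |κ|` vectors, indexed by `κ × Fin 2`:
`2^{-|κ|} ∑_σ sgn σ ∏ᵢ α i (v_{σ(i,0)}, v_{σ(i,1)})`. -/
def wedge {κ : Type*} [Fintype κ] [DecidableEq κ] (α : κ → V [⋀^Fin 2]→L[ℝ] ℂ)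
    (v : κ × Fin 2 → V) : ℂ :=
  (1 / 2 ^ Fintype.card κ : ℂ) * ∑ σ : Equiv.Perm (κ × Fin 2),
    ((Equiv.Perm.sign σ : ℤ) : ℂ) * ∏ i : κ, α i ![v (σ (i, 0)), v (σ (i, 1))]

/-- The pointwise condition in the definition of an almost c-symplectic form (on a real vector
space of dimension `4n`): `(α ∧ ᾱ)^n ≠ 0` and `α^{n+1} = 0`. -/
def IsCSymplecticAt (n : ℕ) (α : V [⋀^Fin 2]→L[ℝ] ℂ) : Prop :=
  (∃ v : (Fin n × Bool) × Fin 2 → V,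
    wedge (fun i : Fin n × Bool => if i.2 then conjForm α else α) v ≠ 0) ∧
  ∀ v : Fin (n + 1) × Fin 2 → V, wedge (fun _ : Fin (n + 1) => α) v = 0

/-- `J` is a complex structure operator for which `α` is a non-degenerate form of Hodge
type (2,0), that is, a complex-linear symplectic form on `(V, J)`. -/
structure IsInducedAt (α : V [⋀^Fin 2]→L[ℝ] ℂ) (J : V →L[ℝ] V) : Prop where
  sq_eq : ∀ u, J (J u) = -u
  linear : ∀ u v, α ![J u, v] = Complex.I * α ![u, v]
  nondegenerate : ∀ u, (∀ v, α ![u, v] = 0) → u = 0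

/-- The complex-bilinear extension of `α` to `V ⊗ ℂ`, evaluated at `a + √-1 b` and `c + √-1 d`. -/
def complexify (α : V [⋀^Fin 2]→L[ℝ] ℂ) (a b c d : V) : ℂ :=
  α ![a, c] - α ![b, d] + Complex.I * (α ![a, d] + α ![b, c])

/-- `α` is of Hodge type (2,0)+(1,1) with respect to `J`: it vanishes on pairs of (0,1)-vectors;
these are the vectors `u + √-1 J u` with `u` real. -/
def IsType20Add11At (J : V →L[ℝ] V) (α : V [⋀^Fin 2]→L[ℝ] ℂ) : Prop :=
  ∀ u v : V, complexify α u (J u) v (J v) = 0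

/-- A real subspace on which `α` vanishes. -/
def IsCIsotropic (α : V [⋀^Fin 2]→L[ℝ] ℂ) (U : Submodule ℝ V) : Prop :=
  ∀ u ∈ U, ∀ v ∈ U, α ![u, v] = 0

/-- A real subspace which is maximal among the c-isotropic ones. -/
def IsCLagrangian (α : V [⋀^Fin 2]→L[ℝ] ℂ) (U : Submodule ℝ V) : Prop :=
  Maximal (IsCIsotropic α) U

end Linear

/-! ### Forms and almost complex structures on a manifold

`X` is a manifold modelled on the complex vector space `E`; `E` is also regarded as a real vector
space, and `TangentSpace 𝓘(ℝ, E) x` is the real tangent space of `X` at `x`. -/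

section Manifold

variable (E : Type*) [NormedAddCommGroup E] [NormedSpace ℂ E]
  (X : Type*) [TopologicalSpace X] [ChartedSpace E X]

/-- Complex-valued 2-forms on `X` (no regularity imposed). -/
abbrev TwoForm : Type _ := ∀ x : X, TangentSpace 𝓘(ℝ, E) x [⋀^Fin 2]→L[ℝ] ℂ

/-- Fields of endomorphisms of the real tangent bundle of `X` (no regularity imposed). -/
abbrev EndField : Type _ := ∀ x : X, TangentSpace 𝓘(ℝ, E) x →L[ℝ] TangentSpace 𝓘(ℝ, E) x

/-- The complex structure operator of a complex manifold: multiplication by `√-1` on tangent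
spaces. (The tangent space at `x` is identified with `E` through the preferred chart at `x`, which
is holomorphic.) -/
def stdJ : EndField E X := fun _ => (Complex.I • ContinuousLinearMap.id ℝ E : E →L[ℝ] E)

variable {E X}

/-- The expression of a 2-form in a chart: its pullback by the inverse of the chart. -/
def TwoForm.inChart (α : TwoForm E X) (e : OpenPartialHomeomorph X E) (y : E) :
    E [⋀^Fin 2]→L[ℝ] ℂ :=
  (α (e.symm y)).compContinuousLinearMap (mfderiv 𝓘(ℝ, E) 𝓘(ℝ, E) e.symm y)

/-- `α` is smooth. -/
def TwoForm.IsSmooth (α : TwoForm E X) : Prop :=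
  ∀ x : X, ContDiffOn ℝ ∞ (TwoForm.inChart α (chartAt E x)) (chartAt E x).target

/-- `dα = 0`. -/
def TwoForm.IsClosed (α : TwoForm E X) : Prop :=
  ∀ x : X, ∀ y ∈ (chartAt E x).target, extDeriv (TwoForm.inChart α (chartAt E x)) y = 0

/-- A c-symplectic form on a manifold of real dimension `4n`: a smooth closed complex-valued 2-form
such that `(α ∧ ᾱ)^n` is nowhere zero and `α^{n+1} = 0`. -/
structure IsCSymplectic (n : ℕ) (α : TwoForm E X) : Prop where
  smooth : TwoForm.IsSmooth α
  closed : TwoForm.IsClosed α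
  pointwise : ∀ x, IsCSymplecticAt n (α x)

/-- `J` is an almost complex structure for which `α` is a non-degenerate form of
type (2,0). -/
def IsInduced (α : TwoForm E X) (J : EndField E X) : Prop :=
  ∀ x, IsInducedAt (α x) (J x)

/-- The expression of a field of endomorphisms in a chart. -/
def EndField.inChart (J : EndField E X) (e : OpenPartialHomeomorph X E) (y : E) : E →L[ℝ] E :=
  (mfderiv 𝓘(ℝ, E) 𝓘(ℝ, E) e (e.symm y)).comp
    ((J (e.symm y)).comp (mfderiv 𝓘(ℝ, E) 𝓘(ℝ, E) e.symm y))

/-- `J` is smooth. -/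
def EndField.IsSmooth (J : EndField E X) : Prop :=
  ∀ x : X, ContDiffOn ℝ ∞ (EndField.inChart J (chartAt E x)) (chartAt E x).target

/-- The Nijenhuis tensor `N(u,v) = [Ju,Jv] - J[Ju,v] - J[u,Jv] - [u,v]` of a field of endomorphisms
`K` of an open subset of `E`, evaluated at the vectors `u`, `v` (extended to constant vector fields,
for which `[u,v] = 0`). -/
def nijenhuis (K : E → E →L[ℝ] E) (u v : E) (y : E) : E :=
  VectorField.lieBracket ℝ (fun z => K z u) (fun z => K z v) y
    - K y (VectorField.lieBracket ℝ (fun z => K z u) (fun _ => v) y)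
    - K y (VectorField.lieBracket ℝ (fun _ => u) (fun z => K z v) y)

/-- The almost complex structure `J` is integrable in the sense that its Nijenhuis tensor
vanishes. -/
def EndField.IsIntegrable (J : EndField E X) : Prop :=
  ∀ x : X, ∀ y ∈ (chartAt E x).target, ∀ u v : E, nijenhuis (EndField.inChart J (chartAt E x)) u v y = 0

/-- Near `x` the set `Z` is a smooth submanifold (in a suitable smooth real chart of `X` around `x`
it is an affine subspace), and `T` is its tangent space at `x`. If `Z` is a complex analytic
subset, the points `x` with this property are exactly its regular points, and they are dense in
`Z`. -/
def IsSmoothPoint (Z : Set X) (x : X) (T : Submodule ℝ (TangentSpace 𝓘(ℝ, E) x)) : Prop :=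
  ∃ φ ∈ IsManifold.maximalAtlas 𝓘(ℝ, E) ∞ X, x ∈ φ.source ∧ ∃ W : Submodule ℝ E,
    (∀ y ∈ φ.source, y ∈ Z ↔ φ y - φ x ∈ W) ∧
    T = W.comap (mfderiv 𝓘(ℝ, E) 𝓘(ℝ, E) φ x).toLinearMap

/-- `Z` (possibly singular) is Lagrangian: the tangent spaces at its regular points
are Lagrangian. -/
def IsLagrangianSubset (α : TwoForm E X) (Z : Set X) : Prop :=
  ∀ x T, IsSmoothPoint Z x T → IsCLagrangian (α x) T

/-- `(X, J, α)` is a holomorphically symplectic manifold, up to integrability of `J`: `α` is a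
smooth closed non-degenerate form of type (2,0) with respect to `J`. (If `J` is the
operator of a complex manifold, such an `α` is automatically holomorphic.) -/
structure IsHolomorphicSymplectic (J : EndField E X) (α : TwoForm E X) : Prop where
  smooth : TwoForm.IsSmooth α
  closed : TwoForm.IsClosed α
  induced : IsInduced α J

variable {F : Type*} [NormedAddCommGroup F] [NormedSpace ℂ F]
  {B : Type*} [TopologicalSpace B] [ChartedSpace F B]

/-- The pullback of a 2-form. -/
def pullback (π : X → B) (η : TwoForm F B) : TwoForm E X := fun x =>
  (η (π x)).compContinuousLinearMap (mfderiv 𝓘(ℝ, E) 𝓘(ℝ, F) π x)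

/-- `π : (X, J) → B` is a holomorphic map to the complex manifold `B`, all of whose fibers are
Lagrangian with respect to `α`. Singular and multiple fibers are allowed. -/
structure IsLagrangianFibration (J : EndField E X) (α : TwoForm E X) (π : X → B) : Prop where
  smooth : ContMDiff 𝓘(ℝ, E) 𝓘(ℝ, F) ∞ π
  holomorphic : ∀ (x : X) (v : TangentSpace 𝓘(ℝ, E) x),
    mfderiv 𝓘(ℝ, E) 𝓘(ℝ, F) π x (J x v) = stdJ F B (π x) (mfderiv 𝓘(ℝ, E) 𝓘(ℝ, F) π x v)
  lagrangian : ∀ b : B, IsLagrangianSubset α (π ⁻¹' {b})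

/-- The forms `Ω_t = Ω + t π^* η`. -/
def deformedForm (Ω : TwoForm E X) (π : X → B) (η : TwoForm F B) (t : ℂ) : TwoForm E X :=
  fun x => Ω x + t • pullback π η x

end Manifold

end CSymp

end

noncomputable section

namespace CSymp

/-! At a point `x` the problem is linear algebra. Put α = t π^*η, D = d_xπ, K = ker D, and look for
I_t = I + N with N taking values in K. Since α vanishes as soon as one argument lies in K, the
equation Ω_t(I_t u, v) = √-1 Ω_t(u, v) becomes Ω(Nu, v) = √-1 α(u, v) - α(Iu, v). The type
(2,0)+(1,1) of α says exactly that the right side is complex linear in v, so non-degeneracy of Ω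
yields N (`IsInducedAt.exists_correction`). If K is coisotropic for Ω, then N does map into K;
moreover N kills K and anticommutes with I, so N² = 0 and (I + N)² = -1. Thus I_t = I on K and D I_t
= D I. Coisotropy also makes Ω_t non-degenerate (`IsInducedAt.exists_deformation`), and
non-degeneracy makes I_t unique.

The geometric point is that ker d_xπ is coisotropic at every x, also on singular or multiple fibers.
Every open set contains a point near which the rank of dπ is constant; there the fiber is a
submanifold with tangent space ker dπ, and the Lagrangian hypothesis applies. Coisotropy then passes
to the limit, although the kernels may jump (`isCoisotropicKer_of_frequently`).

The rest holds for any closed non-degenerate form of type (2,0). Its operator is -(Re)⁻¹ ∘ Im of the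
form, hence smooth. The (0,1)-vectors are the kernel of the form on the complexified tangent space,
and closedness makes them involutive, which is the vanishing of the Nijenhuis tensor
(`nijenhuis_eq_zero`). A symplectic basis shows that the form is pointwise c-symplectic
(`IsInducedAt.isCSymplecticAt`). -/

/-! ### Symplectic families -/

/-- The standard symplectic form on a two-element set. -/
def stdSign (k l : Fin 2) : ℂ := if k = l then 0 else if k = 0 then 1 else -1

/-- Induction on `n`: a hyperbolic plane spanned by `u`, `v` splits off, and its orthogonal
complement `W` is again symplectic, of dimension smaller by 2. -/
theorem exists_symplectic_family (n : ℕ) :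
    ∀ {V : Type*} [AddCommGroup V] [Module ℂ V] (B : V →ₗ[ℂ] V →ₗ[ℂ] ℂ)
      (_ : ∀ u, B u u = 0) (_ : ∀ u, (∀ v, B u v = 0) → u = 0)
      (_ : Module.finrank ℂ V = 2 * n),
      ∃ e : Fin n → Fin 2 → V, ∀ i k j l, B (e i k) (e j l) = if i = j then stdSign k l else 0 := by
  induction n with
  | zero => intro V _ _ B _ _ _; exact ⟨fun i => i.elim0, fun i => i.elim0⟩
  | succ n ih =>
    intro V _ _ B halt hnd hfin
    have hfd : FiniteDimensional ℂ V := Module.finite_of_finrank_pos (by omega)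
    have hanti : ∀ u v, B u v = - B v u := by
      intro u v
      have h := halt (u + v)
      simp only [map_add, LinearMap.add_apply, halt, zero_add, add_zero] at h
      linear_combination h
    have hnt : Nontrivial V := Module.nontrivial_of_finrank_pos (R := ℂ) (by omega)
    obtain ⟨u, hu⟩ := exists_ne (0 : V)
    obtain ⟨w, hw⟩ : ∃ w, B u w ≠ 0 := by
      by_contra! h
      exact hu (hnd u h)
    set v := (B u w)⁻¹ • w with hv
    have huv : B u v = 1 := by simp [hv, hw]
    have hvu : B v u = -1 := by rw [hanti, huv]
    let f : V →ₗ[ℂ] ℂ × ℂ := (B u).prod (B v)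
    have hsurj : LinearMap.range f = ⊤ := by
      rw [LinearMap.range_eq_top]
      rintro ⟨a, b⟩
      refine ⟨a • v - b • u, ?_⟩
      simp [f, huv, hvu, halt]
    have hker := LinearMap.finrank_range_add_finrank_ker f
    rw [hsurj, finrank_top, hfin, Module.finrank_prod, Module.finrank_self] at hker
    let W := LinearMap.ker f
    have hWu : ∀ x : W, B u x = 0 := fun x => congrArg Prod.fst (LinearMap.mem_ker.1 x.2)
    have hWv : ∀ x : W, B v x = 0 := fun x => congrArg Prod.snd (LinearMap.mem_ker.1 x.2)
    have hWu' : ∀ x : W, B x u = 0 := fun x => by rw [hanti, hWu, neg_zero]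
    have hWv' : ∀ x : W, B x v = 0 := fun x => by rw [hanti, hWv, neg_zero]
    obtain ⟨e, he⟩ := ih (B.domRestrict₁₂ W W) (fun x => halt x) (by
      intro x hx
      apply Subtype.ext
      apply hnd
      intro y
      -- The projection of `y` to `W` along the plane; it has the same pairing with `x ∈ W` as `y`.
      have hy : y - B u y • v + B v y • u ∈ W := by
        simp [W, f, huv, hvu, halt]
      have h1 := hx ⟨_, hy⟩
      simpa [LinearMap.domRestrict₁₂_apply, hWu', hWv'] using h1)
      (by change Module.finrank ℂ (LinearMap.ker f) = _; omega)
    refine ⟨Fin.cons ![u, v] (fun i k => (e i k : V)), ?_⟩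
    intro i k j l
    refine Fin.cases ?_ (fun i => ?_) i <;> refine Fin.cases ?_ (fun j => ?_) j
    · fin_cases k <;> fin_cases l <;> simp [halt, huv, hvu, stdSign]
    · have := (Fin.succ_ne_zero j).symm
      fin_cases k <;> simp [hWu, hWv, this]
    · fin_cases l <;> simp [hWu', hWv']
    · have := he i k j l
      simpa [LinearMap.domRestrict₁₂_apply] using this

/-! ### The wedge product of 2-forms -/

/-- `v ↦ ∏ᵢ B (v (i, 0)) (v (i, 1))`. -/
def prodBilin {κ R V : Type*} [Fintype κ] [DecidableEq κ] [CommSemiring R] [AddCommMonoid V]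
    [Module R V] (B : V →ₗ[R] V →ₗ[R] R) : MultilinearMap R (fun _ : κ × Fin 2 => V) R :=
  MultilinearMap.mk' (fun v => ∏ i : κ, B (v (i, 0)) (v (i, 1)))
    (by
      rintro v ⟨i, k⟩ x y
      rw [← Finset.mul_prod_erase Finset.univ _ (Finset.mem_univ i),
        ← Finset.mul_prod_erase Finset.univ _ (Finset.mem_univ i),
        ← Finset.mul_prod_erase Finset.univ _ (Finset.mem_univ i)]
      have h : ∀ z : V, ∏ j ∈ Finset.univ.erase i, B (Function.update v (i, k) z (j, 0))
          (Function.update v (i, k) z (j, 1)) = ∏ j ∈ Finset.univ.erase i, B (v (j, 0)) (v (j, 1)) :=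
        fun z => Finset.prod_congr rfl fun j hj => by
          have hj := Finset.ne_of_mem_erase hj
          simp [Function.update_of_ne, hj]
      rw [h, h, h, ← add_mul]
      fin_cases k <;> simp)
    (by
      rintro v ⟨i, k⟩ c x
      rw [← Finset.mul_prod_erase Finset.univ _ (Finset.mem_univ i),
        ← Finset.mul_prod_erase Finset.univ _ (Finset.mem_univ i)]
      have h : ∀ z : V, ∏ j ∈ Finset.univ.erase i, B (Function.update v (i, k) z (j, 0))
          (Function.update v (i, k) z (j, 1)) = ∏ j ∈ Finset.univ.erase i, B (v (j, 0)) (v (j, 1)) :=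
        fun z => Finset.prod_congr rfl fun j hj => by
          have hj := Finset.ne_of_mem_erase hj
          simp [Function.update_of_ne, hj]
      rw [h, h, smul_eq_mul, ← mul_assoc]
      fin_cases k <;> simp)

/-- The sum is the alternatization of `prodBilin B`, and an alternating map vanishes on linearly
dependent families. -/
theorem sum_sign_prod_eq_zero {κ V : Type*} [Fintype κ] [DecidableEq κ] [AddCommGroup V]
    [Module ℂ V] [FiniteDimensional ℂ V] (B : V →ₗ[ℂ] V →ₗ[ℂ] ℂ)
    (h : Module.finrank ℂ V < 2 * Fintype.card κ) (v : κ × Fin 2 → V) :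
    ∑ σ : Equiv.Perm (κ × Fin 2), ((Equiv.Perm.sign σ : ℤ) : ℂ) *
      ∏ i : κ, B (v (σ (i, 0))) (v (σ (i, 1))) = 0 := by
  have hdep : ¬ LinearIndependent ℂ v := by
    intro hli
    have := hli.fintype_card_le_finrank
    simp only [Fintype.card_prod, Fintype.card_fin] at this
    omega
  have := (MultilinearMap.alternatization (prodBilin (κ := κ) B)).map_linearDependent v hdep
  rw [MultilinearMap.alternatization_apply] at this
  rw [← this]
  refine Finset.sum_congr rfl fun σ _ => ?_
  rw [MultilinearMap.domDomCongr_apply]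
  simp [prodBilin, Units.smul_def]

/-- A permutation of `κ × Fin 2` that maps pairs to pairs contributes with a positive sign. -/
theorem sign_mul_prod_stdSign {κ : Type*} [Fintype κ] [DecidableEq κ]
    (σ : Equiv.Perm (κ × Fin 2)) (h : ∀ i, (σ (i, 0)).1 = (σ (i, 1)).1) :
    ((Equiv.Perm.sign σ : ℤ) : ℂ) * ∏ i, stdSign (σ (i, 0)).2 (σ (i, 1)).2 = 1 := by
  have hne : ∀ i, (σ (i, 0)).2 ≠ (σ (i, 1)).2 := by
    intro i hi
    have := σ.injective (Prod.ext (h i) hi)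
    simp at this
  have hinj : Function.Injective fun i => (σ (i, 0)).1 := by
    intro i j hij
    -- Otherwise `σ (i, 0)`, `σ (j, 0)`, `σ (j, 1)` would be three distinct points over one element
    -- of `κ`, which has only two.
    by_contra hne'
    have h1 : (σ (i, 0)).2 ≠ (σ (j, 0)).2 := fun h' => by
      have := σ.injective (Prod.ext hij h'); simp [hne'] at this
    have h2 : (σ (i, 0)).2 ≠ (σ (j, 1)).2 := fun h' => by
      have := σ.injective (Prod.ext (hij.trans (h j)) h'); simp at this
    have h3 := hne j
    revert h1 h2 h3
    generalize (σ (i, 0)).2 = a; generalize (σ (j, 0)).2 = b; generalize (σ (j, 1)).2 = c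
    revert a b c; decide
  let τ : Equiv.Perm κ := Equiv.ofBijective _ (Finite.injective_iff_bijective.1 hinj)
  let s : κ → Equiv.Perm (Fin 2) := fun i => if (σ (i, 0)).2 = 0 then 1 else Equiv.swap 0 1
  -- Swaps inside the pairs, followed by the permutation `τ` of the pairs. The latter has sign (sgn
  -- τ)² = 1, and each swap has the sign of the corresponding factor `stdSign`.
  have hσ : σ = Equiv.prodCongrLeft (fun _ => τ) * Equiv.prodCongrRight s := by
    ext1 ⟨i, k⟩
    have h2 := hne i
    have h1 := h i
    have : σ (i, k) = ((σ (i, 0)).1, s i k) := by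
      refine Prod.ext ?_ ?_
      · fin_cases k
        · rfl
        · exact h1.symm
      · simp only [s]
        revert h2
        fin_cases k <;> simp only [Fin.zero_eta, Fin.mk_one] <;>
        generalize (σ (i, 0)).2 = a <;> generalize (σ (i, 1)).2 = b <;> revert a b <;> decide
    rw [this]; rfl
  have hsign : Equiv.Perm.sign σ = ∏ i, Equiv.Perm.sign (s i) := by
    rw [hσ, map_mul, Equiv.Perm.sign_prodCongrLeft, Equiv.Perm.sign_prodCongrRight]
    simp
  rw [hsign]
  push_cast
  rw [← Finset.prod_mul_distrib]
  refine Finset.prod_eq_one fun i _ => ?_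
  have h2 := hne i
  simp only [s, stdSign]
  rw [if_neg h2]
  split_ifs <;> simp

/-! ### Bilinear calculus of 2-forms and the complex structure attached to a (2,0)-form -/

section RealForms

variable {V : Type*} [AddCommGroup V] [Module ℝ V] [TopologicalSpace V]

theorem form_add_left (α : V [⋀^Fin 2]→L[ℝ] ℂ) (u u' v : V) :
    α ![u + u', v] = α ![u, v] + α ![u', v] := by
  exact α.toContinuousMultilinearMap.cons_add ![v] u u'

theorem form_smul_left (α : V [⋀^Fin 2]→L[ℝ] ℂ) (c : ℝ) (u v : V) :
    α ![c • u, v] = c * α ![u, v] := by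
  exact (α.toContinuousMultilinearMap.cons_smul ![v] c u).trans (Complex.real_smul ..)

theorem form_swap (α : V [⋀^Fin 2]→L[ℝ] ℂ) (u v : V) : α ![u, v] = - α ![v, u] := by
  have := α.toAlternatingMap.map_swap ![v, u] (i := 0) (j := 1) (by simp)
  rw [show ![u, v] = ![v, u] ∘ Equiv.swap 0 1 by ext i; fin_cases i <;> simp]
  exact this

theorem form_self (α : V [⋀^Fin 2]→L[ℝ] ℂ) (u : V) : α ![u, u] = 0 :=
  α.map_eq_zero_of_eq ![u, u] (i := 0) (j := 1) rfl (by simp)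

/-- A 2-form as a bilinear map. -/
def bilin (α : V [⋀^Fin 2]→L[ℝ] ℂ) : V →ₗ[ℝ] V →ₗ[ℝ] ℂ :=
  LinearMap.mk₂ ℝ (fun u v => α ![u, v]) (form_add_left α)
    (fun c u v => by rw [form_smul_left, Complex.real_smul])
    (fun u v v' => by
      rw [form_swap, form_add_left, form_swap α v u, form_swap α v' u]; ring)
    (fun c u v => by
      rw [form_swap, form_smul_left, form_swap α v u, Complex.real_smul]; ring)

theorem bilin_apply (α : V [⋀^Fin 2]→L[ℝ] ℂ) (u v : V) : bilin α u v = α ![u, v] := rfl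

theorem form_add_right (α : V [⋀^Fin 2]→L[ℝ] ℂ) (u v v' : V) :
    α ![u, v + v'] = α ![u, v] + α ![u, v'] := (bilin α u).map_add v v'

theorem form_smul_right (α : V [⋀^Fin 2]→L[ℝ] ℂ) (c : ℝ) (u v : V) :
    α ![u, c • v] = c * α ![u, v] :=
  ((bilin α u).map_smul c v).trans (Complex.real_smul ..)

theorem form_neg_left (α : V [⋀^Fin 2]→L[ℝ] ℂ) (u v : V) : α ![-u, v] = - α ![u, v] :=
  congrArg (fun f => f v) ((bilin α).map_neg u)

theorem form_sub_left (α : V [⋀^Fin 2]→L[ℝ] ℂ) (u u' v : V) :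
    α ![u - u', v] = α ![u, v] - α ![u', v] := by
  rw [sub_eq_add_neg, form_add_left, form_neg_left, sub_eq_add_neg]

theorem form_zero_left (α : V [⋀^Fin 2]→L[ℝ] ℂ) (v : V) : α ![0, v] = 0 :=
  congrArg (fun f => f v) ((bilin α).map_zero)

theorem conjForm_apply (α : V [⋀^Fin 2]→L[ℝ] ℂ) (v : Fin 2 → V) :
    conjForm α v = (starRingEnd ℂ) (α v) := rfl

namespace IsInducedAt

variable {α : V [⋀^Fin 2]→L[ℝ] ℂ} {J : V →L[ℝ] V}

theorem linear_right (h : IsInducedAt α J) (u v : V) :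
    α ![u, J v] = Complex.I * α ![u, v] := by
  rw [form_swap, h.linear, form_swap α v u]; ring

theorem eq_of_forall (h : IsInducedAt α J) {u u' : V} (huu : ∀ v, α ![u, v] = α ![u', v]) :
    u = u' := by
  rw [← sub_eq_zero]
  refine h.nondegenerate _ fun v => ?_
  rw [form_sub_left, huu, sub_self]

theorem unique (h : IsInducedAt α J) {J' : V →L[ℝ] V} (h' : IsInducedAt α J') : J = J' := by
  ext u
  exact h.eq_of_forall fun v => by rw [h.linear, h'.linear]

theorem mul_self (h : IsInducedAt α J) :
    (J.toLinearMap * J.toLinearMap : Module.End ℝ V) = -1 := by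
  ext u; simp [h.sq_eq]

/-- The complex vector space structure defined by `J`. -/
abbrev module (h : IsInducedAt α J) : Module ℂ V :=
  Module.compHom V (Complex.liftAux (A := Module.End ℝ V) J.toLinearMap
    h.mul_self).toRingHom

theorem module_smul (h : IsInducedAt α J) (z : ℂ) (u : V) :
    (letI := h.module; z • u) = z.re • u + z.im • J u := by
  change (Complex.liftAux (A := Module.End ℝ V) J.toLinearMap h.mul_self z) u = _
  rw [Complex.liftAux_apply]
  simp [Algebra.algebraMap_eq_smul_one]

/-- Complex linearity on the left is part of `IsInducedAt`; antisymmetry carries it to the right. -/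
theorem exists_complex_bilin (h : IsInducedAt α J) :
    letI := h.module
    ∃ B : V →ₗ[ℂ] V →ₗ[ℂ] ℂ, ∀ u v, B u v = α ![u, v] := by
  let := h.module
  have h1 : ∀ (z : ℂ) (u v : V), α ![z • u, v] = z * α ![u, v] := by
    intro z u v
    rw [h.module_smul, form_add_left, form_smul_left, form_smul_left, h.linear]
    conv_rhs => rw [← Complex.re_add_im z]
    ring
  refine ⟨LinearMap.mk₂ ℂ (fun u v => α ![u, v]) (form_add_left α) h1 (form_add_right α) ?_,
    fun _ _ => rfl⟩
  intro z u v
  rw [form_swap, h1, form_swap α v u, smul_eq_mul]; ring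

theorem finrank_module (h : IsInducedAt α J) [FiniteDimensional ℝ V] :
    letI := h.module
    FiniteDimensional ℂ V ∧ Module.finrank ℝ V = 2 * Module.finrank ℂ V := by
  let := h.module
  have : IsScalarTower ℝ ℂ V := ⟨fun r z u => by
    rw [h.module_smul, h.module_smul]
    simp [smul_add, mul_smul]⟩
  have hfd : FiniteDimensional ℂ V := FiniteDimensional.right ℝ ℂ V
  refine ⟨hfd, ?_⟩
  rw [← Module.finrank_mul_finrank ℝ ℂ V, Complex.finrank_real_complex]

end IsInducedAt

end RealForms

/-! ### Non-degenerate (2,0)-forms are pointwise c-symplectic -/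

section CSymplectic

variable {V : Type*} [AddCommGroup V] [Module ℝ V] [TopologicalSpace V]

/-- If a wedge product vanishes on real vectors, then it vanishes on complex vectors
`∑ c, a p c ⊗ x p c`. -/
theorem sum_sign_prod_complexified_eq_zero {κ ι : Type*} [Fintype κ] [DecidableEq κ] [Fintype ι]
    [DecidableEq ι] (α : κ → V [⋀^Fin 2]→L[ℝ] ℂ) (h : ∀ v, wedge α v = 0)
    (a : κ × Fin 2 → ι → ℂ) (x : κ × Fin 2 → ι → V) :
    ∑ σ : Equiv.Perm (κ × Fin 2), ((Equiv.Perm.sign σ : ℤ) : ℂ) * ∏ i : κ,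
      ∑ c : ι, ∑ d : ι, a (σ (i, 0)) c * a (σ (i, 1)) d *
        α i ![x (σ (i, 0)) c, x (σ (i, 1)) d] = 0 := by
  have h' : ∀ v : κ × Fin 2 → V, ∑ σ : Equiv.Perm (κ × Fin 2), ((Equiv.Perm.sign σ : ℤ) : ℂ) *
      ∏ i : κ, α i ![v (σ (i, 0)), v (σ (i, 1))] = 0 := by
    intro v
    have := h v
    rw [wedge, mul_eq_zero] at this
    exact this.resolve_left (by simp)
  -- Multilinear expansion: `c` selects a real component for each argument, and the inner sum is a
  -- wedge product on real vectors.
  have key : ∑ c : κ × Fin 2 → ι, (∏ p, a p (c p)) * ∑ σ : Equiv.Perm (κ × Fin 2),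
      ((Equiv.Perm.sign σ : ℤ) : ℂ) *
      ∏ i : κ, α i ![x (σ (i, 0)) (c (σ (i, 0))), x (σ (i, 1)) (c (σ (i, 1)))] = 0 :=
    Finset.sum_eq_zero fun c _ => by rw [h' fun p => x p (c p), mul_zero]
  rw [← key]
  simp_rw [Finset.mul_sum]
  rw [Finset.sum_comm]
  refine Finset.sum_congr rfl fun σ _ => ?_
  simp_rw [mul_left_comm _ ((Equiv.Perm.sign σ : ℤ) : ℂ), ← Finset.mul_sum]
  congr 1
  rw [Finset.prod_congr rfl fun i _ => (Fintype.sum_prod_type' _).symm, Finset.prod_univ_sum]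
  rw [Fintype.piFinset_univ]
  -- Distributing the product gives one pair of choices for each `i`. The reindexing assigns the
  -- choice in position `(i, k)` to the argument `σ (i, k)`.
  refine Fintype.sum_equiv
    (((Equiv.arrowCongr (Equiv.refl κ) (finTwoArrowEquiv ι).symm).trans
      (Equiv.curry κ (Fin 2) ι).symm).trans (Equiv.arrowCongr σ (Equiv.refl ι))) _ _ ?_
  intro c
  rw [← Equiv.prod_comp σ, Fintype.prod_prod_type, ← Finset.prod_mul_distrib]
  refine Finset.prod_congr rfl fun i _ => ?_
  simp

/-- The first condition is tested on the (1,0)- and (0,1)-parts of a symplectic basis, where all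
nonzero terms have the same sign. For the second, `2 * (n + 1)` vectors are dependent in a complex
space of dimension `2 * n`. -/
theorem IsInducedAt.isCSymplecticAt {α : V [⋀^Fin 2]→L[ℝ] ℂ} {J : V →L[ℝ] V}
    (h : IsInducedAt α J) [FiniteDimensional ℝ V] (n : ℕ) (hn : Module.finrank ℝ V = 4 * n) :
    IsCSymplecticAt n α := by
  let := h.module
  obtain ⟨hfd, hfin⟩ := h.finrank_module
  obtain ⟨B, hB⟩ := h.exists_complex_bilin
  constructor
  · by_contra! hw
    obtain ⟨e, he⟩ := exists_symplectic_family n B (fun u => by rw [hB, form_self])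
      (fun u hu => h.nondegenerate u fun v => by rw [← hB, hu]) (by omega)
    simp only [hB] at he
    -- the vectors `e i k ∓ √-1 J (e i k)` of type (1,0) and (0,1)
    let a : (Fin n × Bool) × Fin 2 → Bool → ℂ := fun p c =>
      if c then (if p.1.2 then Complex.I else -Complex.I) else 1
    let x : (Fin n × Bool) × Fin 2 → Bool → V := fun p c =>
      if c then J (e p.1.1 p.2) else e p.1.1 p.2
    have h0 := sum_sign_prod_complexified_eq_zero
      (fun i : Fin n × Bool => if i.2 then conjForm α else α) hw a x
    have hconj : ∀ k l, (starRingEnd ℂ) (stdSign k l) = stdSign k l := by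
      intro k l; unfold stdSign; split_ifs <;> simp
    have hcalc : ∀ (i : Fin n × Bool) (p q : (Fin n × Bool) × Fin 2),
        ∑ c : Bool, ∑ d : Bool, a p c * a q d *
          (if i.2 then conjForm α else α) ![x p c, x q d] =
        if p.1.2 = i.2 ∧ q.1.2 = i.2 ∧ p.1.1 = q.1.1 then 4 * stdSign p.2 q.2 else 0 := by
      rintro ⟨i, b⟩ ⟨⟨j, b'⟩, k⟩ ⟨⟨j', b''⟩, l⟩
      have hI := Complex.I_mul_I
      by_cases hj : j = j'
      · subst hj
        cases b <;> cases b' <;> cases b'' <;>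
          simp [a, x, conjForm_apply, h.linear, h.linear_right, he, hconj] <;>
          ring_nf <;> simp [Complex.I_sq] <;> ring
      · cases b <;> cases b' <;> cases b'' <;>
          simp [a, x, conjForm_apply, h.linear, h.linear_right, he, hj]
    simp only [hcalc] at h0
    -- A permutation contributes only if it maps pairs to pairs and respects types; it then
    -- contributes 4^(2n), whatever its sign. So nothing cancels, and the identity makes the sum
    -- positive.
    have hterm : ∀ σ : Equiv.Perm ((Fin n × Bool) × Fin 2),
        ((Equiv.Perm.sign σ : ℤ) : ℂ) * ∏ i : Fin n × Bool,
          (if (σ (i, 0)).1.2 = i.2 ∧ (σ (i, 1)).1.2 = i.2 ∧ (σ (i, 0)).1.1 = (σ (i, 1)).1.1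
            then 4 * stdSign (σ (i, 0)).2 (σ (i, 1)).2 else 0) =
        if ∀ i, (σ (i, 0)).1.2 = i.2 ∧ (σ (i, 1)).1.2 = i.2 ∧ (σ (i, 0)).1.1 = (σ (i, 1)).1.1
          then ((4 : ℕ) : ℂ) ^ Fintype.card (Fin n × Bool) else 0 := by
      intro σ
      split_ifs with hσ
      · rw [Finset.prod_congr rfl fun i _ => if_pos (hσ i), Finset.prod_mul_distrib,
          mul_left_comm, sign_mul_prod_stdSign σ fun i =>
            Prod.ext (hσ i).2.2 ((hσ i).1.trans (hσ i).2.1.symm)]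
        simp
      · obtain ⟨i, hi⟩ := not_forall.1 hσ
        rw [Finset.prod_eq_zero (Finset.mem_univ i) (if_neg hi), mul_zero]
    rw [Finset.sum_congr rfl fun σ _ => hterm σ, ← Finset.sum_filter, Finset.sum_const,
      nsmul_eq_mul, mul_eq_zero] at h0
    rcases h0 with h0 | h0
    · rw [Nat.cast_eq_zero, Finset.card_eq_zero] at h0
      have : (1 : Equiv.Perm ((Fin n × Bool) × Fin 2)) ∈ (∅ : Finset _) := by
        rw [← h0]; simp
      simp at this
    · exact absurd h0 (by simp)
  · intro v
    have := sum_sign_prod_eq_zero (κ := Fin (n + 1)) B (by rw [Fintype.card_fin]; omega) v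
    simp only [hB] at this
    rw [wedge, this, mul_zero]

end CSymplectic

/-! ### Deforming a linear holomorphic symplectic form -/

section Linear

variable {V : Type*} [AddCommGroup V] [Module ℝ V] [TopologicalSpace V]
  {U : Type*} [AddCommGroup U] [Module ℝ U] [TopologicalSpace U]

/-- The kernel of `D` is coisotropic. -/
def IsCoisotropicKer (β : V [⋀^Fin 2]→L[ℝ] ℂ) (D : V →L[ℝ] U) : Prop :=
  ∀ u, (∀ v, D v = 0 → β ![u, v] = 0) → D u = 0

/-- Adjoining `u` keeps `T` isotropic, so maximality absorbs it: a Lagrangian subspace contains its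
orthogonal complement. -/
theorem IsCLagrangian.mem_of_forall {β : V [⋀^Fin 2]→L[ℝ] ℂ} {T : Submodule ℝ V}
    (hT : IsCLagrangian β T) {u : V} (hu : ∀ v ∈ T, β ![u, v] = 0) : u ∈ T := by
  have hiso : IsCIsotropic β (T ⊔ Submodule.span ℝ {u}) := by
    intro x hx y hy
    obtain ⟨x, hxT, _, hx', rfl⟩ := Submodule.mem_sup.1 hx
    obtain ⟨y, hyT, _, hy', rfl⟩ := Submodule.mem_sup.1 hy
    obtain ⟨r, rfl⟩ := Submodule.mem_span_singleton.1 hx'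
    obtain ⟨s, rfl⟩ := Submodule.mem_span_singleton.1 hy'
    simp only [form_add_left, form_add_right, form_smul_left, form_smul_right, form_self,
      hT.1 x hxT y hyT, hu y hyT, form_swap β x u, hu x hxT]
    simp
  exact hT.2 hiso le_sup_left
    (Submodule.mem_sup_right (Submodule.mem_span_singleton_self u))

variable {β : V [⋀^Fin 2]→L[ℝ] ℂ} {I : V →L[ℝ] V} {α : V [⋀^Fin 2]→L[ℝ] ℂ}

/-- A (2,0)+(1,1)-form: `i α(u, ·) - α(I u, ·)` is complex linear. -/
theorem IsType20Add11At.linear_right (hα : IsType20Add11At I α)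
    (u v : V) : Complex.I * α ![u, I v] - α ![I u, I v] =
      Complex.I * (Complex.I * α ![u, v] - α ![I u, v]) := by
  have h := hα u v
  rw [complexify] at h
  linear_combination h + (-α ![u, v]) * Complex.I_mul_I

/-- Every functional on a finite-dimensional complex symplectic space is given by a vector. -/
theorem IsInducedAt.exists_re_eq [FiniteDimensional ℝ V] (h : IsInducedAt β I)
    (l : V →ₗ[ℝ] ℝ) : ∃ u, ∀ v, (β ![u, v]).re = l v := by
  let f : V →ₗ[ℝ] (V →ₗ[ℝ] ℝ) := (bilin β).compr₂ Complex.reLm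
  have hinj : Function.Injective f := by
    rw [← LinearMap.ker_eq_bot, LinearMap.ker_eq_bot']
    intro u hu
    refine h.nondegenerate u fun v => ?_
    have h1 : (β ![u, v]).re = 0 := LinearMap.congr_fun hu v
    have h2 : (β ![u, I v]).re = 0 := LinearMap.congr_fun hu (I v)
    rw [h.linear_right] at h2
    apply Complex.ext <;> simp_all
  have hsurj : Function.Surjective f :=
    (LinearMap.injective_iff_surjective_of_finrank_eq_finrank
      (Subspace.dual_finrank_eq (K := ℝ) (V := V)).symm).1 hinj
  obtain ⟨u, hu⟩ := hsurj l
  exact ⟨u, fun v => LinearMap.congr_fun hu v⟩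

/-- The correction term `N = J - I`. -/
theorem IsInducedAt.exists_correction [FiniteDimensional ℝ V] [IsTopologicalAddGroup V]
    [ContinuousSMul ℝ V] [T2Space V] (h : IsInducedAt β I)
    (hα : IsType20Add11At I α) :
    ∃ N : V →L[ℝ] V, ∀ u v, β ![N u, v] = Complex.I * α ![u, v] - α ![I u, v] := by
  have h1 : ∀ u, ∃ w, ∀ v, β ![w, v] = Complex.I * α ![u, v] - α ![I u, v] := by
    intro u
    obtain ⟨w, hw⟩ := h.exists_re_eq
      (Complex.reLm ∘ₗ (Complex.I • bilin α u - bilin α (I u)))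
    refine ⟨w, fun v => ?_⟩
    have hv := hw v
    -- Both sides are complex linear in `v`, so equality of real parts at `I v` is equality of
    -- imaginary parts at `v`.
    have hv' := hw (I v)
    simp only [LinearMap.comp_apply, LinearMap.sub_apply, LinearMap.smul_apply, bilin_apply,
      smul_eq_mul, Complex.reLm_coe, hα.linear_right, h.linear_right] at hv hv'
    apply Complex.ext
    · exact hv
    · simp only [Complex.mul_re, Complex.I_re, Complex.I_im, zero_mul, one_mul, zero_sub] at hv'
      exact neg_injective hv'
  choose N hN using h1
  refine ⟨LinearMap.toContinuousLinearMap
    { toFun := N, map_add' := fun u u' => ?_, map_smul' := fun c u => ?_ }, hN⟩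
  · refine h.eq_of_forall fun v => ?_
    rw [form_add_left, hN, hN, hN, map_add, form_add_left, form_add_left]; ring
  · refine h.eq_of_forall fun v => ?_
    rw [RingHom.id_apply, form_smul_left, hN, hN, map_smul, form_smul_left, form_smul_left]; ring

variable {D : V →L[ℝ] U}

/-- A linear holomorphic symplectic form, deformed by a (2,0)+(1,1)-form that is pulled back along
a complex-linear map with coisotropic kernel, induces a complex structure. -/
theorem IsInducedAt.exists_deformation [FiniteDimensional ℝ V] [IsTopologicalAddGroup V]
    [ContinuousSMul ℝ V] [T2Space V] (h : IsInducedAt β I)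
    (hα : IsType20Add11At I α) (hD : IsCoisotropicKer β D) (hαD : ∀ u v, D u = 0 → α ![u, v] = 0)
    (hDI : ∀ u, D u = 0 → D (I u) = 0) :
    ∃ J : V →L[ℝ] V, IsInducedAt (β + α) J ∧ (∀ u, D (J u) = D (I u)) ∧
      ∀ u, D u = 0 → J u = I u := by
  obtain ⟨N, hN⟩ := h.exists_correction hα
  have hαD' : ∀ u v, D v = 0 → α ![u, v] = 0 := fun u v hv => by
    rw [form_swap, hαD v u hv, neg_zero]
  -- `N u` is orthogonal to the kernel of `D`, hence lies in it by coisotropy.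
  have hDN : ∀ u, D (N u) = 0 := fun u => hD _ fun v hv => by
    rw [hN, hαD' _ _ hv, hαD' _ _ hv, mul_zero, sub_zero]
  have hNK : ∀ u, D u = 0 → N u = 0 := fun u hu => h.nondegenerate _ fun v => by
    rw [hN, hαD u v hu, hαD _ v (hDI u hu), mul_zero, sub_zero]
  have hNI : ∀ u, N (I u) = - I (N u) := fun u => h.eq_of_forall fun v => by
    rw [hN, form_neg_left, h.linear, hN, h.sq_eq, form_neg_left]
    linear_combination (α ![u, v]) * Complex.I_mul_I
  -- The square is I² + (IN + NI) + N² = -1, with N² = 0 because `N` maps into the kernel of `D` and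
  -- vanishes on it.
  refine ⟨I + N, ⟨fun u => ?_, fun u v => ?_, fun u hu => ?_⟩, fun u => ?_, fun u hu => ?_⟩
  · simp only [_root_.add_apply, map_add, h.sq_eq, hNI, hNK _ (hDN u)]
    abel
  · simp only [_root_.add_apply, ContinuousAlternatingMap.add_apply, form_add_left,
      h.linear, hN, hαD _ v (hDN u)]
    ring
  · have hu' : ∀ v, β ![u, v] = - α ![u, v] := fun v => by
      have := hu v
      rw [ContinuousAlternatingMap.add_apply] at this
      linear_combination this
    -- A null vector of `β + α` is `β`-orthogonal to the kernel of `D`, so it lies there; then `α`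
    -- no longer sees it.
    have hDu : D u = 0 := hD u fun v hv => by rw [hu', hαD' u v hv, neg_zero]
    exact h.nondegenerate u fun v => by rw [hu', hαD u v hDu, neg_zero]
  · simp [hDN]
  · simp [hNK u hu]

/-- The deformed form has the same Lagrangian subspaces inside the kernel of `D`. -/
theorem IsCLagrangian.add_of_le_ker {T : Submodule ℝ V} (hT : IsCLagrangian β T)
    (hαT : ∀ u ∈ T, ∀ v, α ![u, v] = 0) : IsCLagrangian (β + α) T := by
  refine ⟨fun u hu v hv => ?_, fun T' hT' hle u hu => ?_⟩
  · rw [ContinuousAlternatingMap.add_apply, hT.1 u hu v hv, hαT u hu, add_zero]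
  · refine hT.mem_of_forall fun v hv => ?_
    have := hT' u hu v (hle hv)
    rwa [ContinuousAlternatingMap.add_apply, form_swap α, hαT v hv, neg_zero, add_zero] at this

theorem IsInducedAt.mem_of_isCLagrangian (h : IsInducedAt β I) {T : Submodule ℝ V}
    (hT : IsCLagrangian β T) {v : V} (hv : v ∈ T) : I v ∈ T :=
  hT.mem_of_forall fun w hw => by rw [h.linear, hT.1 v hv w hw, mul_zero]

end Linear

/-! ### Smoothness, limits and integrability for forms on a vector space -/

set_option maxSynthPendingDepth 3

section Local

open Filter Topology

variable {E : Type*} [NormedAddCommGroup E] [NormedSpace ℝ E]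

/-- A 2-form as a continuous bilinear map. -/
def bilinL : (E [⋀^Fin 2]→L[ℝ] ℂ) →L[ℝ] E →L[ℝ] E →L[ℝ] ℂ :=
  (ContinuousLinearMap.compL ℝ E (E [⋀^Fin 1]→L[ℝ] ℂ) (E →L[ℝ] ℂ)
    ((ContinuousAlternatingMap.ofSubsingletonLIE (𝕜 := ℝ) (E := E) (F := ℂ)
      (0 : Fin 1)).symm.toContinuousLinearEquiv : _ →L[ℝ] _)) ∘L
    (ContinuousAlternatingMap.curryLeftLI (𝕜 := ℝ) (E := E) (F := ℂ) (n := 1)).toContinuousLinearMap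

theorem bilinL_apply (α : E [⋀^Fin 2]→L[ℝ] ℂ) (u v : E) : bilinL α u v = α ![u, v] := by
  change α (Matrix.vecCons u (fun _ : Fin 1 => v)) = _
  congr 1
  ext i; fin_cases i <;> rfl

attribute [irreducible] bilinL

theorem ext_form {α β : E [⋀^Fin 2]→L[ℝ] ℂ} (h : ∀ u v, α ![u, v] = β ![u, v]) : α = β := by
  ext v
  rw [show v = ![v 0, v 1] by ext i; fin_cases i <;> rfl]
  exact h _ _

/-- A family of 2-forms is as smooth as its values on pairs of vectors. -/
theorem contDiffAt_form [FiniteDimensional ℝ E] {D : Type*} [NormedAddCommGroup D]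
    [NormedSpace ℝ D] {k : ℕ∞ω} {β : D → E [⋀^Fin 2]→L[ℝ] ℂ} {x : D}
    (h : ContDiffAt ℝ k (fun y => bilinL (β y)) x) : ContDiffAt ℝ k β x := by
  have hinj : (bilinL (E := E)).toLinearMap.ker = ⊥ :=
    LinearMap.ker_eq_bot'.2 fun α hα => ext_form fun u v => by
      rw [← bilinL_apply, show bilinL α = 0 from hα]
      rfl
  obtain ⟨g, hg⟩ := LinearMap.exists_leftInverse_of_injective _ hinj
  have : β = fun y => LinearMap.toContinuousLinearMap g (bilinL (β y)) := by
    ext1 y; exact (LinearMap.congr_fun hg (β y)).symm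
  rw [this]
  exact (ContinuousLinearMap.contDiff _).contDiffAt.comp x h

theorem contDiffAt_pullback_form [FiniteDimensional ℝ E] {F : Type*} [NormedAddCommGroup F]
    [NormedSpace ℝ F] {β : F → F [⋀^Fin 2]→L[ℝ] ℂ} {f : E → F} {x : E}
    (hβ : ContDiffAt ℝ ∞ β (f x)) (hf : ContDiffAt ℝ ∞ f x) :
    ContDiffAt ℝ ∞ (fun y => (β (f y)).compContinuousLinearMap (fderiv ℝ f y)) x := by
  apply contDiffAt_form
  have hf' : ContDiffAt ℝ ∞ (fderiv ℝ f) x := hf.fderiv_right (by simp)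
  have h1 : ContDiffAt ℝ ∞ (fun y => bilinL (β (f y))) x :=
    (ContinuousLinearMap.contDiff _).contDiffAt.comp x (hβ.comp x hf)
  have : (fun y => bilinL ((β (f y)).compContinuousLinearMap (fderiv ℝ f y))) =
      fun y => (ContinuousLinearMap.compL ℝ E F ℂ).flip (fderiv ℝ f y) ∘L
        (bilinL (β (f y)) ∘L fderiv ℝ f y) := by
    ext y u v
    rw [bilinL_apply]
    simp only [ContinuousLinearMap.comp_apply, ContinuousLinearMap.flip_apply,
      ContinuousLinearMap.compL_apply]
    rw [bilinL_apply, ContinuousAlternatingMap.compContinuousLinearMap_apply]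
    congr 1
    ext i; fin_cases i <;> rfl
  rw [this]
  exact (((ContinuousLinearMap.contDiff _).contDiffAt.comp x hf')).clm_comp (h1.clm_comp hf')

/-- The real part of a 2-form as a map to the dual space. -/
def reDual : (E [⋀^Fin 2]→L[ℝ] ℂ) →L[ℝ] E →L[ℝ] E →L[ℝ] ℝ :=
  ContinuousLinearMap.compL ℝ E (E →L[ℝ] ℂ) (E →L[ℝ] ℝ)
    (ContinuousLinearMap.compL ℝ E ℂ ℝ Complex.reCLM) ∘L bilinL

/-- The imaginary part of a 2-form as a map to the dual space. -/
def imDual : (E [⋀^Fin 2]→L[ℝ] ℂ) →L[ℝ] E →L[ℝ] E →L[ℝ] ℝ :=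
  ContinuousLinearMap.compL ℝ E (E →L[ℝ] ℂ) (E →L[ℝ] ℝ)
    (ContinuousLinearMap.compL ℝ E ℂ ℝ Complex.imCLM) ∘L bilinL

theorem reDual_apply (α : E [⋀^Fin 2]→L[ℝ] ℂ) (u v : E) : reDual α u v = (α ![u, v]).re := by
  rw [← bilinL_apply]; rfl

theorem imDual_apply (α : E [⋀^Fin 2]→L[ℝ] ℂ) (u v : E) : imDual α u v = (α ![u, v]).im := by
  rw [← bilinL_apply]; rfl

theorem IsInducedAt.isInvertible_reDual [FiniteDimensional ℝ E] {α : E [⋀^Fin 2]→L[ℝ] ℂ}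
    {J : E →L[ℝ] E} (h : IsInducedAt α J) : (reDual α).IsInvertible := by
  have hinj : Function.Injective (reDual α) := by
    rw [← LinearMap.coe_coe, ← LinearMap.ker_eq_bot, LinearMap.ker_eq_bot']
    intro u hu
    have hu' : ∀ v, (α ![u, v]).re = 0 := fun v => by
      rw [← reDual_apply]
      exact congrArg (fun f : E →L[ℝ] ℝ => f v) hu
    refine h.nondegenerate u fun v => ?_
    have h2 := hu' (J v)
    rw [h.linear_right] at h2
    apply Complex.ext
    · exact hu' v
    · simpa using h2
  have hsurj : Function.Surjective (reDual α) := fun l => by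
    obtain ⟨u, hu⟩ := h.exists_re_eq l.toLinearMap
    exact ⟨u, by ext v; rw [reDual_apply, hu]; rfl⟩
  exact ⟨(LinearEquiv.ofBijective (reDual α).toLinearMap ⟨hinj, hsurj⟩).toContinuousLinearEquiv,
    by ext; rfl⟩

/-- Taking real parts in α(Ju, v) = √-1 α(u, v) gives Re α(Ju, ·) = -Im α(u, ·). The formula makes
`J` as regular as `α`. -/
theorem IsInducedAt.eq_inverse_comp [FiniteDimensional ℝ E] {α : E [⋀^Fin 2]→L[ℝ] ℂ}
    {J : E →L[ℝ] E} (h : IsInducedAt α J) : J = -((reDual α).inverse ∘L imDual α) := by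
  have hinv := h.isInvertible_reDual
  have : reDual α ∘L J = - imDual α := by
    ext u v
    rw [ContinuousLinearMap.comp_apply, reDual_apply, h.linear, _root_.neg_apply, _root_.neg_apply,
      imDual_apply]
    simp
  rw [← ContinuousLinearMap.comp_neg, ← this, ← ContinuousLinearMap.comp_assoc,
    hinv.inverse_comp_self, ContinuousLinearMap.id_comp]

theorem contDiffAt_of_isInducedAt [FiniteDimensional ℝ E] {k : ℕ∞ω}
    {β : E → E [⋀^Fin 2]→L[ℝ] ℂ} {K : E → E →L[ℝ] E} {x : E}
    (h : ∀ᶠ y in 𝓝 x, IsInducedAt (β y) (K y)) (hβ : ContDiffAt ℝ k β x) :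
    ContDiffAt ℝ k K x := by
  have hK : K =ᶠ[𝓝 x] fun y => -((reDual (β y)).inverse ∘L imDual (β y)) :=
    h.mono fun y hy => hy.eq_inverse_comp
  refine ContDiffAt.congr_of_eventuallyEq ?_ hK
  have h1 : ContDiffAt ℝ k (fun y => reDual (β y)) x :=
    (ContinuousLinearMap.contDiff _).contDiffAt.comp x hβ
  have h2 : ContDiffAt ℝ k (fun y => imDual (β y)) x :=
    (ContinuousLinearMap.contDiff _).contDiffAt.comp x hβ
  exact ((h.self_of_nhds.isInvertible_reDual.contDiffAt_map_inverse.comp x h1).clm_comp h2).neg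

/-- The coisotropy of the kernels of a continuous family of linear maps is a closed condition. -/
theorem isCoisotropicKer_of_frequently [FiniteDimensional ℝ E] {F : Type*} [NormedAddCommGroup F]
    [NormedSpace ℝ F] [FiniteDimensional ℝ F]
    {β : E → E [⋀^Fin 2]→L[ℝ] ℂ} {K : E → E →L[ℝ] E} {D : E → E →L[ℝ] F} {x : E}
    (h : ∀ᶠ y in 𝓝 x, IsInducedAt (β y) (K y)) (hβ : ContinuousAt β x) (hD : ContinuousAt D x)
    (hKD : ∀ᶠ y in 𝓝 x, ∀ v, D y v = 0 → D y (K y v) = 0)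
    (hf : ∃ᶠ y in 𝓝 x, IsCoisotropicKer (β y) (D y)) :
    IsCoisotropicKer (β x) (D x) := by
  intro u hu
  -- The functional Re β(u, ·) vanishes on the kernel of `D x`, so it factors through `D x`.
  obtain ⟨l, hl⟩ : ∃ l : F →ₗ[ℝ] ℝ, l ∘ₗ (D x).toLinearMap = (reDual (β x) u).toLinearMap := by
    have hle : (reDual (β x) u).toLinearMap ∈ ((D x).toLinearMap).dualMap.range := by
      rw [LinearMap.range_dualMap_eq_dualAnnihilator_ker, Submodule.mem_dualAnnihilator]
      intro w hw
      have := hu w hw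
      change reDual (β x) u w = 0
      rw [reDual_apply, this, Complex.zero_re]
    exact hle
  let L : F →L[ℝ] ℝ := LinearMap.toContinuousLinearMap l
  -- Keeping `L` fixed extends `u` to a continuous field orthogonal to the kernel of `D y` for `y`
  -- near `x`, even where the rank of `D` jumps. Where coisotropy holds, `D y (U y) = 0`, and this
  -- equation survives in the limit.
  let U : E → E := fun y => (reDual (β y)).inverse (L ∘L D y)
  have hUx : U x = u := by
    have : L ∘L D x = reDual (β x) u := by
      ext v; exact LinearMap.congr_fun hl v
    change (reDual (β x)).inverse _ = u
    rw [this]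
    exact congrArg (fun f : E →L[ℝ] E => f u)
      h.self_of_nhds.isInvertible_reDual.inverse_comp_self
  have hUcont : ContinuousAt U x := by
    have h1 : ContinuousAt (fun y => (reDual (β y)).inverse) x :=
      ContinuousAt.comp (g := ContinuousLinearMap.inverse) (f := fun y => reDual (β y))
        (h.self_of_nhds.isInvertible_reDual.contDiffAt_map_inverse (𝕜 := ℝ) (n := 0)).continuousAt
        (reDual.continuous.continuousAt.comp hβ)
    exact h1.clm_apply (continuousAt_const.clm_comp hD)
  have hzero : ∃ᶠ y in 𝓝 x, D y (U y) = 0 := by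
    refine ((hf.and_eventually h).and_eventually hKD).mono ?_
    rintro y ⟨⟨hy, hind⟩, hKy⟩
    apply hy
    have hre : ∀ v, D y v = 0 → (β y ![U y, v]).re = 0 := by
      intro v hv
      have : reDual (β y) (U y) = L ∘L D y :=
        congrArg (fun f : (E →L[ℝ] ℝ) →L[ℝ] (E →L[ℝ] ℝ) => f (L ∘L D y))
          hind.isInvertible_reDual.self_comp_inverse
      rw [← reDual_apply, this, ContinuousLinearMap.comp_apply, hv, map_zero]
    intro v hv
    -- The kernel is stable under `K y`, so vanishing of the real part gives vanishing of the
    -- imaginary part.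
    have h2 := hre _ (hKy v hv)
    rw [hind.linear_right] at h2
    apply Complex.ext
    · exact hre v hv
    · simpa using h2
  rw [← hUx]
  by_contra hne
  exact hzero ((hD.clm_apply hUcont).eventually_ne hne)

theorem fderiv_form_apply {D : Type*} [NormedAddCommGroup D] [NormedSpace ℝ D]
    {β : D → E [⋀^Fin 2]→L[ℝ] ℂ} {f : D → E} {f' : D →L[ℝ] E} {x : D}
    (hβ : DifferentiableAt ℝ β x) (hf : HasFDerivAt f f' x) (b : E) (w : D) :
    fderiv ℝ (fun y => β y ![f y, b]) x w = fderiv ℝ β x w ![f x, b] + β x ![f' w, b] := by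
  have h1 : HasFDerivAt (fun y => bilinL (β y)) (bilinL ∘L fderiv ℝ β x) x :=
    bilinL.hasFDerivAt.comp x hβ.hasFDerivAt
  have h2 := ((h1.clm_apply hf).clm_apply (hasFDerivAt_const b x)).fderiv
  simp only [bilinL_apply] at h2
  rw [h2]
  simp [bilinL_apply, add_comm]

/-- The closedness of a 2-form, evaluated at constant vector fields. -/
theorem extDeriv_form_apply {β : E → E [⋀^Fin 2]→L[ℝ] ℂ} {x : E} (hβ : DifferentiableAt ℝ β x)
    (a b c : E) : extDeriv β x ![a, b, c] =
      fderiv ℝ β x a ![b, c] - fderiv ℝ β x b ![a, c] + fderiv ℝ β x c ![a, b] := by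
  rw [extDeriv_apply hβ, Fin.sum_univ_three]
  have e0 : Fin.removeNth (0 : Fin 3) ![a, b, c] = ![b, c] := by
    ext i; fin_cases i <;> rfl
  have e1 : Fin.removeNth (1 : Fin 3) ![a, b, c] = ![a, c] := by
    ext i; fin_cases i <;> rfl
  have e2 : Fin.removeNth (2 : Fin 3) ![a, b, c] = ![a, b] := by
    ext i; fin_cases i <;> rfl
  have hAd : ∀ a b w, fderiv ℝ (fun y => β y ![a, b]) x w = fderiv ℝ β x w ![a, b] := by
    intro a b w
    rw [fderiv_form_apply hβ (hasFDerivAt_const a x)]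
    simp [form_zero_left]
  rw [e0, e1, e2, hAd, hAd, hAd]
  simp
  ring

/-- The derivative of the equation `β (K u, v) = √-1 β (u, v)`. -/
theorem form_fderiv_apply {β : E → E [⋀^Fin 2]→L[ℝ] ℂ} {K : E → E →L[ℝ] E} {x : E}
    (h : ∀ᶠ y in 𝓝 x, IsInducedAt (β y) (K y)) (hβ : DifferentiableAt ℝ β x)
    (hK : DifferentiableAt ℝ K x) (w a b : E) :
    β x ![fderiv ℝ K x w a, b] =
      Complex.I * fderiv ℝ β x w ![a, b] - fderiv ℝ β x w ![K x a, b] := by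
  have h4 : (fun y => β y ![K y a, b]) =ᶠ[𝓝 x] fun y => (Complex.I • β y) ![a, b] :=
    h.mono fun y hy => hy.linear a b
  have h5 := congrArg (fun f : E →L[ℝ] ℂ => f w) h4.fderiv_eq
  have h6 := fderiv_form_apply hβ (hK.hasFDerivAt.clm_apply (hasFDerivAt_const a x)) b w
  have h7 := fderiv_form_apply (hβ.const_smul Complex.I) (hasFDerivAt_const a x) b w
  have h8 : fderiv ℝ (Complex.I • β) x = Complex.I • fderiv ℝ β x :=
    fderiv_const_smul hβ Complex.I
  simp only [Pi.smul_apply] at h7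
  rw [h7, h6] at h5
  simp [form_zero_left, h8] at h5
  linear_combination h5

/-- The Nijenhuis tensor of the almost complex structure induced by a closed form vanishes. -/
theorem nijenhuis_eq_zero {E : Type*} [NormedAddCommGroup E] [NormedSpace ℂ E] {β : E → E [⋀^Fin 2]→L[ℝ] ℂ} {K : E → E →L[ℝ] E} {x : E}
    (h : ∀ᶠ y in 𝓝 x, IsInducedAt (β y) (K y)) (hβ : DifferentiableAt ℝ β x)
    (hK : DifferentiableAt ℝ K x) (hd : extDeriv β x = 0) (u v : E) :
    nijenhuis K u v x = 0 := by
  have hx := h.self_of_nhds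
  let A : E → E → E → ℂ := fun w a b => fderiv ℝ β x w ![a, b]
  have hA : ∀ a b c, A a b c - A b a c + A c a b = 0 := fun a b c => by
    rw [← extDeriv_form_apply hβ, hd]; rfl
  have hDK : ∀ w a b, β x ![fderiv ℝ K x w a, b] = Complex.I * A w a b - A w (K x a) b :=
    form_fderiv_apply h hβ hK
  have hD' : ∀ a w, fderiv ℝ (fun z => K z a) x w = fderiv ℝ K x w a := by
    intro a w; rw [(hK.hasFDerivAt.clm_apply (hasFDerivAt_const a x)).fderiv]; simp
  refine hx.nondegenerate _ fun w => ?_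
  rw [nijenhuis, form_sub_left, form_sub_left, hx.linear, hx.linear]
  simp only [VectorField.lieBracket, hD', fderiv_fun_const, Pi.zero_apply, _root_.zero_apply]
  simp only [form_sub_left, form_zero_left, hDK]
  have hsym : ∀ c a b, A c a b = - A c b a := fun c a b => form_swap _ a b
  -- The left side is the pairing of the derivative of `K` along `w`, applied to `u`, with `K x v`;
  -- it is complex linear in the second slot.
  have h7 : Complex.I * A w u (K x v) - A w (K x u) (K x v) =
      Complex.I * (Complex.I * A w u v - A w (K x u) v) := by
    rw [← hDK, ← hDK, hx.linear_right]
  -- Closedness on the four triples with `u` or `K u`, `v` or `K v`, and `w` cancels the derivatives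
  -- along `u`, `v`, `K u`, `K v`; `h7` removes those along `w`.
  linear_combination Complex.I * hA (K x u) v w - hA (K x u) (K x v) w +
    Complex.I * hA u (K x v) w + hA u v w - h7 +
    (A v u w - A u v w - A w u v) * Complex.I_mul_I

end Local

/-! ### Semicontinuity of the rank and the constant rank theorem -/

section ConstantRank

open Filter Topology

variable {E : Type*} [NormedAddCommGroup E] [NormedSpace ℝ E] [FiniteDimensional ℝ E]
  {F : Type*} [NormedAddCommGroup F] [NormedSpace ℝ F]

/-- If `A` is close to `D`, then `ker A ⊆ ker (D g A)`, and the dimension of the latter is at most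
that of `ker D`. -/
theorem finrank_ker_le_of_injective {D A : E →L[ℝ] F} {g : F →L[ℝ] E}
    (hg : ∀ u, D (g (D u)) = D u)
    (hinj : Function.Injective (g ∘L A + (ContinuousLinearMap.id ℝ E - g ∘L D))) :
    Module.finrank ℝ (D ∘L g ∘L A).toLinearMap.ker ≤ Module.finrank ℝ D.toLinearMap.ker := by
  let M : E →ₗ[ℝ] E := (g ∘L A + (ContinuousLinearMap.id ℝ E - g ∘L D)).toLinearMap
  have hM : ∀ u ∈ (D ∘L g ∘L A).toLinearMap.ker, M u ∈ D.toLinearMap.ker := by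
    intro u hu
    have hu' : D (g (A u)) = 0 := hu
    change D (g (A u) + (u - g (D u))) = 0
    rw [map_add, map_sub, hu', hg, sub_self, add_zero]
  exact LinearMap.finrank_le_finrank_of_injective (f := M.restrict hM)
    fun u v huv => Subtype.ext (hinj (congrArg Subtype.val huv))

/-- At `y = x` the operator is the identity, and invertible operators form an open set. -/
theorem eventually_injective {D : E → E →L[ℝ] F} {x : E} (hD : ContinuousAt D x)
    (g : F →L[ℝ] E) :
    ∀ᶠ y in 𝓝 x, Function.Injective (g ∘L D y + (ContinuousLinearMap.id ℝ E - g ∘L D x)) := by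
  have hc : ContinuousAt (fun y => g ∘L D y + (ContinuousLinearMap.id ℝ E - g ∘L D x)) x :=
    (continuousAt_const.clm_comp hD).add continuousAt_const
  have hu : IsUnit (g ∘L D x + (ContinuousLinearMap.id ℝ E - g ∘L D x)) := by
    rw [add_sub_cancel]; exact isUnit_one
  filter_upwards [hc.eventually (Units.isOpen.mem_nhds hu)] with y hy
  obtain ⟨e, he⟩ := hy
  rw [← he]
  exact (ContinuousLinearEquiv.unitsEquiv ℝ E e).injective

variable [FiniteDimensional ℝ F]

theorem exists_generalized_inverse (D : E →L[ℝ] F) :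
    ∃ g : F →L[ℝ] E, ∀ u, D (g (D u)) = D u := by
  obtain ⟨s, hs⟩ := (D.toLinearMap.rangeRestrict).exists_rightInverse_of_surjective
    (LinearMap.range_rangeRestrict _)
  obtain ⟨p, hp⟩ := D.toLinearMap.range.subtype.exists_leftInverse_of_injective
    (Submodule.ker_subtype _)
  refine ⟨LinearMap.toContinuousLinearMap (s ∘ₗ p), fun u => ?_⟩
  have h1 : p (D u) = D.toLinearMap.rangeRestrict u :=
    LinearMap.congr_fun hp (D.toLinearMap.rangeRestrict u)
  have h2 := LinearMap.congr_fun hs (D.toLinearMap.rangeRestrict u)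
  have h3 := congrArg Subtype.val h2
  change D (s (p (D u))) = D u
  rw [h1]
  exact h3

theorem eventually_finrank_ker_le {D : E → E →L[ℝ] F} {x : E} (hD : ContinuousAt D x) :
    ∀ᶠ y in 𝓝 x, Module.finrank ℝ (D y).toLinearMap.ker ≤
      Module.finrank ℝ (D x).toLinearMap.ker := by
  obtain ⟨g, hg⟩ := exists_generalized_inverse (D x)
  filter_upwards [eventually_injective hD g] with y hy
  refine le_trans (Submodule.finrank_mono ?_) (finrank_ker_le_of_injective hg hy)
  intro u hu
  have hu' : D y u = 0 := hu
  change D x (g (D y u)) = 0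
  rw [hu', map_zero, map_zero]

/-- The points near which the rank is constant are dense. -/
theorem exists_constant_rank {D : E → E →L[ℝ] F} {s : Set E} (hs : IsOpen s) (hne : s.Nonempty)
    (hD : ContinuousOn D s) :
    ∃ x ∈ s, ∀ᶠ y in 𝓝 x, Module.finrank ℝ (D y).toLinearMap.ker =
      Module.finrank ℝ (D x).toLinearMap.ker := by
  let f : E → ℕ := fun y => Module.finrank ℝ (D y).toLinearMap.ker
  have hne' : (f '' s).Nonempty := hne.image f
  -- A point of `s` with kernel of least dimension: nearby kernels cannot be larger by
  -- semicontinuity, nor smaller by minimality.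
  obtain ⟨x, hx, hfx⟩ := Nat.sInf_mem hne'
  refine ⟨x, hx, ?_⟩
  filter_upwards [eventually_finrank_ker_le (hD.continuousAt (hs.mem_nhds hx)), hs.mem_nhds hx]
    with y hy hys
  refine le_antisymm hy ?_
  change f x ≤ f y
  rw [hfx]
  exact Nat.sInf_le ⟨y, hys, rfl⟩

/-- The constant rank theorem: if the derivative of `f` has constant rank near `x`, then the fiber
of `f` through `x` is an affine subspace in a suitable chart. -/
theorem exists_straightening {f : E → F} {x : E} {s : Set E} (hs : s ∈ 𝓝 x)
    (hf : ContDiffOn ℝ ∞ f s)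
    (hr : ∀ᶠ y in 𝓝 x, Module.finrank ℝ (fderiv ℝ f y).toLinearMap.ker =
      Module.finrank ℝ (fderiv ℝ f x).toLinearMap.ker) :
    ∃ φ : OpenPartialHomeomorph E E, x ∈ φ.source ∧ φ.source ⊆ s ∧
      ContDiffOn ℝ ∞ φ φ.source ∧ ContDiffOn ℝ ∞ φ.symm φ.target ∧
      HasFDerivAt φ (ContinuousLinearMap.id ℝ E) x ∧
      ∀ y ∈ φ.source, f y = f x ↔ φ y - φ x ∈ (fderiv ℝ f x).toLinearMap.ker := by
  obtain ⟨g, hg⟩ := exists_generalized_inverse (fderiv ℝ f x)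
  set D := fderiv ℝ f x with hDdef
  set Q : E →L[ℝ] E := ContinuousLinearMap.id ℝ E - g ∘L D with hQ
  have hDQ : ∀ u, D (Q u) = 0 := fun u => by
    change D (u - g (D u)) = 0
    rw [map_sub, hg, sub_self]
  -- At `x` the derivative is gD + (1 - gD) = 1. Since DQ = 0, `D` sees only the part `g ∘ f` of
  -- this map.
  let φ₀ : E → E := fun y => g (f y) + Q y
  have hfx : ContDiffAt ℝ ∞ f x := hf.contDiffAt hs
  have hφ₀ : ∀ y, ContDiffAt ℝ ∞ f y → ContDiffAt ℝ ∞ φ₀ y := fun y hy =>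
    (g.contDiff.contDiffAt.comp y hy).add Q.contDiff.contDiffAt
  have hφ₀' : ∀ y, ContDiffAt ℝ ∞ f y → HasFDerivAt φ₀ (g ∘L fderiv ℝ f y + Q) y := fun y hy =>
    (g.hasFDerivAt.comp y (hy.differentiableAt (by simp)).hasFDerivAt).add Q.hasFDerivAt
  have hder : HasFDerivAt φ₀ ((ContinuousLinearEquiv.refl ℝ E : E ≃L[ℝ] E) : E →L[ℝ] E) x := by
    have := hφ₀' x hfx
    rw [hQ, ← hDdef, add_sub_cancel] at this
    exact this
  have hDcont : ContinuousAt (fderiv ℝ f) x := (hfx.fderiv_right (m := 0) (by simp)).continuousAt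
  let φ₁ := (hφ₀ x hfx).toOpenPartialHomeomorph φ₀ hder (by simp)
  have hφ₁ : ∀ y, φ₁ y = φ₀ y := fun _ => rfl
  have hx₁ : x ∈ φ₁.source := ContDiffAt.mem_toOpenPartialHomeomorph_source _ _ _
  -- a neighbourhood on which everything is fine
  obtain ⟨t, htsub, htopen, hxt⟩ := mem_nhds_iff.1
    (Filter.inter_mem (eventually_eventually_nhds.2 hs)
      (Filter.inter_mem hr (eventually_injective hDcont g)))
  have hft : ∀ y ∈ t, ContDiffAt ℝ ∞ f y := fun y hy => hf.contDiffAt (htsub hy).1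
  -- The constant rank enters here: the kernel of f'(y) is contained in that of D g f'(y), whose
  -- dimension is no larger.
  have hker : ∀ y ∈ t, ∀ u, D (g (fderiv ℝ f y u)) = 0 → fderiv ℝ f y u = 0 := by
    intro y hy u hu
    have hle : (fderiv ℝ f y).toLinearMap.ker ≤ (D ∘L g ∘L fderiv ℝ f y).toLinearMap.ker := by
      intro u hu
      have hu' : fderiv ℝ f y u = 0 := hu
      change D (g (fderiv ℝ f y u)) = 0
      rw [hu', map_zero, map_zero]
    have heq := Submodule.eq_of_le_of_finrank_le hle (by
      rw [(htsub hy).2.1]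
      exact finrank_ker_le_of_injective hg (htsub hy).2.2)
    have : u ∈ (fderiv ℝ f y).toLinearMap.ker := by rw [heq]; exact hu
    exact this
  let φ₂ := φ₁.restrOpen t htopen
  have hx₂ : x ∈ φ₂.source := ⟨hx₁, hxt⟩
  -- Shrinking the target to a ball makes it convex, so that it contains the segments used below.
  obtain ⟨ε, hε, hball⟩ := Metric.isOpen_iff.1 φ₂.open_target _ (φ₂.map_source hx₂)
  let φ := (φ₂.symm.restrOpen _ (Metric.isOpen_ball (x := φ₂ x) (ε := ε))).symm
  have hφcoe : ∀ y, φ y = φ₀ y := fun _ => rfl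
  have hφtarget : φ.target = Metric.ball (φ₀ x) ε := by
    change φ₂.target ∩ Metric.ball (φ₂ x) ε = _
    exact Set.inter_eq_right.2 hball
  have hφsource : φ.source ⊆ t := fun y hy => hy.1.2
  have hxφ : x ∈ φ.source := ⟨hx₂, Metric.mem_ball_self hε⟩
  have hsmooth : ∀ z ∈ φ.target, ContDiffAt ℝ ∞ φ.symm z := by
    intro z hz
    have hy := φ.map_target hz
    have hinj := (htsub (hφsource hy)).2.2
    let e : E ≃L[ℝ] E := (LinearEquiv.ofInjectiveEndo
      (g ∘L fderiv ℝ f (φ.symm z) + Q).toLinearMap hinj).toContinuousLinearEquiv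
    refine φ.contDiffAt_symm (f₀' := e) hz ?_ (hφ₀ _ (hft _ (hφsource hy)))
    have : (e : E →L[ℝ] E) = g ∘L fderiv ℝ f (φ.symm z) + Q := by ext u; rfl
    rw [this]
    exact hφ₀' _ (hft _ (hφsource hy))
  refine ⟨φ, hxφ, fun y hy => ?_, fun y hy => (hφ₀ y (hft y (hφsource hy))).contDiffWithinAt,
    fun z hz => (hsmooth z hz).contDiffWithinAt, hder, fun y hy => ?_⟩
  · exact mem_of_mem_nhds (htsub (hφsource hy)).1
  constructor
  · intro h
    change D (g (f y) + Q y - (g (f x) + Q x)) = 0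
    rw [h, add_sub_add_left_eq_sub, map_sub, hDQ, hDQ, sub_self]
  · intro h
    have hw : D (φ y - φ x) = 0 := h
    set w := φ y - φ x
    -- `f` is constant along the preimage of the segment from `φ x` to `φ y`
    let c : ℝ → E := fun r => φ x + r • w
    have hc : ∀ r ∈ Set.Icc (0 : ℝ) 1, c r ∈ φ.target := by
      intro r hr
      have hconv : Convex ℝ φ.target := by rw [hφtarget]; exact convex_ball _ _
      have := hconv.add_smul_sub_mem (φ.map_source hxφ) (φ.map_source hy) hr
      exact this
    have hcder : ∀ r, HasDerivAt c w r := by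
      intro r
      have := ((hasDerivAt_id r).smul_const w).const_add (φ x)
      rw [one_smul] at this
      exact this
    let b : ℝ → E := fun r => φ.symm (c r)
    have hb : ∀ r ∈ Set.Icc (0 : ℝ) 1, HasDerivAt b (fderiv ℝ φ.symm (c r) w) r := fun r hr =>
      ((hsmooth _ (hc r hr)).differentiableAt (by simp)).hasFDerivAt.comp_hasDerivAt r (hcder r)
    have hbt : ∀ r ∈ Set.Icc (0 : ℝ) 1, b r ∈ t := fun r hr =>
      hφsource (φ.map_target (hc r hr))
    have hfb : ∀ r ∈ Set.Icc (0 : ℝ) 1, HasDerivAt (fun r => f (b r)) 0 r := by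
      intro r hr
      have h1 : HasDerivAt (fun r => f (b r)) (fderiv ℝ f (b r) (fderiv ℝ φ.symm (c r) w)) r :=
        ((hft _ (hbt r hr)).differentiableAt (by simp)).hasFDerivAt.comp_hasDerivAt r (hb r hr)
      have h2 : fderiv ℝ f (b r) (fderiv ℝ φ.symm (c r) w) = 0 := by
        apply hker _ (hbt r hr)
        have h3 : HasDerivAt (fun r => φ₀ (b r))
            ((g ∘L fderiv ℝ f (b r) + Q) (fderiv ℝ φ.symm (c r) w)) r :=
          (hφ₀' _ (hft _ (hbt r hr))).comp_hasDerivAt r (hb r hr)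
        have h4 : (fun r => φ₀ (b r)) =ᶠ[𝓝 r] c := by
          filter_upwards [(hcder r).continuousAt.preimage_mem_nhds
            (φ.open_target.mem_nhds (hc r hr))] with r' hr'
          exact φ.right_inv hr'
        have h5 := ((hcder r).congr_of_eventuallyEq h4).unique h3
        -- The image under `φ₀` of the velocity of `b` is `w`. Applying `D` kills `Q` and `w`, so
        -- `hker` shows that the velocity lies in the kernel of the derivative of `f`.
        have h6 := congrArg D h5
        rw [hw] at h6
        change 0 = D (g (fderiv ℝ f (b r) (fderiv ℝ φ.symm (c r) w)) + Q _) at h6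
        rw [map_add, hDQ, add_zero] at h6
        exact h6.symm
      rwa [h2] at h1
    have hconst := constant_of_has_deriv_right_zero (f := fun r => f (b r)) (a := 0) (b := 1)
      (fun r hr => (hfb r hr).continuousAt.continuousWithinAt)
      (fun r hr => (hfb r (Set.Ico_subset_Icc_self hr)).hasDerivWithinAt) 1 (by simp)
    have hb0 : b 0 = x := by
      simp only [b, c, zero_smul, add_zero]; exact φ.left_inv hxφ
    have hb1 : b 1 = y := by
      simp only [b, c, one_smul, w, add_sub_cancel]; exact φ.left_inv hy
    simpa only [hb0, hb1] using hconst

end ConstantRank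

/-! ### Linear notions under change of coordinates -/

section Transport

variable {V : Type*} [AddCommGroup V] [Module ℝ V] [TopologicalSpace V]
  {V' : Type*} [AddCommGroup V'] [Module ℝ V'] [TopologicalSpace V']
  {U : Type*} [AddCommGroup U] [Module ℝ U] [TopologicalSpace U]
  {U' : Type*} [AddCommGroup U'] [Module ℝ U'] [TopologicalSpace U']

theorem compContinuousLinearMap_apply_pair (α : V [⋀^Fin 2]→L[ℝ] ℂ) (T : V' →L[ℝ] V) (u v : V') :
    α.compContinuousLinearMap T ![u, v] = α ![T u, T v] := by
  rw [ContinuousAlternatingMap.compContinuousLinearMap_apply]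
  congr 1
  ext i; fin_cases i <;> rfl

theorem IsInducedAt.transport {α : V [⋀^Fin 2]→L[ℝ] ℂ} {J : V →L[ℝ] V} (h : IsInducedAt α J)
    {T : V' →L[ℝ] V} {S : V →L[ℝ] V'} (hTS : ∀ u, T (S u) = u) (hST : ∀ u, S (T u) = u) :
    IsInducedAt (α.compContinuousLinearMap T) (S ∘L (J ∘L T)) where
  sq_eq u := by
    simp only [ContinuousLinearMap.comp_apply, hTS, h.sq_eq, map_neg, hST]
  linear u v := by
    simp only [compContinuousLinearMap_apply_pair, ContinuousLinearMap.comp_apply, hTS, h.linear]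
  nondegenerate u hu := by
    have : T u = 0 := h.nondegenerate _ fun v => by
      have := hu (S v)
      rwa [compContinuousLinearMap_apply_pair, hTS] at this
    rw [← hST u, this, map_zero]

theorem isCoisotropicKer_transport {α : V [⋀^Fin 2]→L[ℝ] ℂ} {D : V →L[ℝ] U}
    {T : V' →L[ℝ] V} {S : V →L[ℝ] V'} (hTS : ∀ u, T (S u) = u)
    {P : U →L[ℝ] U'} (hP : Function.Injective P) :
    IsCoisotropicKer (α.compContinuousLinearMap T) (P ∘L (D ∘L T)) ↔ IsCoisotropicKer α D := by
  have h0 : ∀ v, P (D (T v)) = 0 ↔ D (T v) = 0 := fun v => map_eq_zero_iff P hP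
  constructor
  · intro h u hu
    have := h (S u) fun v hv => by
      rw [compContinuousLinearMap_apply_pair, hTS]
      exact hu _ ((h0 v).1 hv)
    rw [← hTS u]
    exact (h0 _).1 this
  · intro h u hu
    refine (h0 u).2 (h _ fun v hv => ?_)
    have := hu (S v) ((h0 _).2 (by rwa [hTS]))
    rwa [compContinuousLinearMap_apply_pair, hTS] at this

end Transport

/-- Complex analytic transition maps are smooth over the reals. -/
theorem isManifold_real {E : Type*} [NormedAddCommGroup E] [NormedSpace ℂ E]
    {X : Type*} [TopologicalSpace X] [ChartedSpace E X] [IsManifold 𝓘(ℂ, E) ω X] :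
    IsManifold 𝓘(ℝ, E) ∞ X := by
  refine isManifold_of_contDiffOn _ _ _ fun e e' he he' => ?_
  have h := (mem_groupoid_of_pregroupoid.1 (StructureGroupoid.compatible
    (contDiffGroupoid ω 𝓘(ℂ, E)) he he')).1
  exact (ContDiffOn.restrict_scalars ℝ h).of_le le_top

/-! ### Passing from the manifold to charts -/

section Charts

open Filter Topology

variable {E : Type*} [NormedAddCommGroup E] [NormedSpace ℂ E]
  {X : Type*} [TopologicalSpace X] [ChartedSpace E X] [IsManifold 𝓘(ℝ, E) ∞ X]
  {F : Type*} [NormedAddCommGroup F] [NormedSpace ℂ F]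
  {B : Type*} [TopologicalSpace B] [ChartedSpace F B] [IsManifold 𝓘(ℝ, F) ∞ B]

theorem mdifferentiable_chartAt (x : X) :
    (chartAt E x).MDifferentiable 𝓘(ℝ, E) 𝓘(ℝ, E) :=
  have : IsManifold 𝓘(ℝ, E) 1 X := .of_le (n := ∞) (by simp)
  mdifferentiable_chart x

theorem mfderiv_chart_symm_apply (x : X) {y : E} (hy : y ∈ (chartAt E x).target) (v : E) :
    mfderiv 𝓘(ℝ, E) 𝓘(ℝ, E) (chartAt E x) ((chartAt E x).symm y)
      (mfderiv 𝓘(ℝ, E) 𝓘(ℝ, E) (chartAt E x).symm y v) = v :=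
  congrArg (fun f : E →L[ℝ] E => f v) ((mdifferentiable_chartAt x).comp_symm_deriv hy)

theorem mfderiv_symm_chart_apply (x : X) {y : E} (hy : y ∈ (chartAt E x).target)
    (v : TangentSpace 𝓘(ℝ, E) ((chartAt E x).symm y)) :
    mfderiv 𝓘(ℝ, E) 𝓘(ℝ, E) (chartAt E x).symm y
      (mfderiv 𝓘(ℝ, E) 𝓘(ℝ, E) (chartAt E x) ((chartAt E x).symm y) v) = v := by
  have := congrArg (fun f : E →L[ℝ] E => f v)
    ((mdifferentiable_chartAt x).symm_comp_deriv ((chartAt E x).map_target hy))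
  rw [(chartAt E x).right_inv hy] at this
  exact this

theorem IsInduced.inChart {α : TwoForm E X} {J : EndField E X} (h : IsInduced α J) (x : X) {y : E}
    (hy : y ∈ (chartAt E x).target) :
    IsInducedAt (α.inChart (chartAt E x) y) (J.inChart (chartAt E x) y) :=
  (h ((chartAt E x).symm y)).transport (mfderiv_symm_chart_apply x hy)
    (mfderiv_chart_symm_apply x hy)

theorem IsInduced.eventually_inChart {α : TwoForm E X} {J : EndField E X} (h : IsInduced α J)
    (x : X) {y : E} (hy : y ∈ (chartAt E x).target) :
    ∀ᶠ z in 𝓝 y, IsInducedAt (α.inChart (chartAt E x) z) (J.inChart (chartAt E x) z) := by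
  filter_upwards [(chartAt E x).open_target.mem_nhds hy] with z hz using h.inChart x hz

omit [IsManifold 𝓘(ℝ, E) ∞ X] in
theorem TwoForm.IsSmooth.contDiffAt {α : TwoForm E X} (h : α.IsSmooth) (x : X) {y : E}
    (hy : y ∈ (chartAt E x).target) : ContDiffAt ℝ ∞ (α.inChart (chartAt E x)) y :=
  (h x).contDiffAt ((chartAt E x).open_target.mem_nhds hy)

theorem IsInduced.isSmooth [FiniteDimensional ℂ E] {α : TwoForm E X} {J : EndField E X}
    (h : IsInduced α J) (hα : α.IsSmooth) : J.IsSmooth := fun x _ hy =>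
  (contDiffAt_of_isInducedAt (h.eventually_inChart x hy) (hα.contDiffAt x hy)).contDiffWithinAt

theorem IsInduced.isIntegrable [FiniteDimensional ℂ E] {α : TwoForm E X} {J : EndField E X}
    (h : IsInduced α J) (hα : α.IsSmooth) (hd : α.IsClosed) : J.IsIntegrable := fun x y hy =>
  nijenhuis_eq_zero (h.eventually_inChart x hy)
    ((hα.contDiffAt x hy).differentiableAt (by simp))
    (((h.isSmooth hα x).contDiffAt ((chartAt E x).open_target.mem_nhds hy)).differentiableAt
      (by simp)) (hd x y hy)

/-! ### Maps in charts -/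

/-- The expression of a map in the charts around `x` and `b`. -/
def mapInChart (π : X → B) (x : X) (b : B) (y : E) : F := chartAt F b (π ((chartAt E x).symm y))

/-- The domain of definition of `mapInChart`. -/
def mapInChartDomain (π : X → B) (x : X) (b : B) : Set E :=
  (chartAt E x).target ∩ (fun y => π ((chartAt E x).symm y)) ⁻¹' (chartAt F b).source

variable {π : X → B}

omit [NormedSpace ℂ E] [NormedSpace ℂ F] [IsManifold 𝓘(ℝ, E) ∞ X] [IsManifold 𝓘(ℝ, F) ∞ B] in
theorem isOpen_mapInChartDomain (hπ : Continuous π) (x : X) (b : B) :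
    IsOpen (mapInChartDomain (E := E) (F := F) π x b) :=
  (hπ.comp_continuousOn (chartAt E x).continuousOn_symm).isOpen_inter_preimage
    (chartAt E x).open_target (chartAt F b).open_source

theorem contDiffAt_mapInChart (hπ : ContMDiff 𝓘(ℝ, E) 𝓘(ℝ, F) ∞ π) {x : X} {b : B} {y : E}
    (hy : y ∈ mapInChartDomain (E := E) (F := F) π x b) :
    ContDiffAt ℝ ∞ (mapInChart π x b : E → F) y := by
  have h1 : ContMDiffAt 𝓘(ℝ, E) 𝓘(ℝ, E) ∞ (chartAt E x).symm y :=
    contMDiffAt_symm_of_mem_maximalAtlas (IsManifold.chart_mem_maximalAtlas x) hy.1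
  have h2 : ContMDiffAt 𝓘(ℝ, F) 𝓘(ℝ, F) ∞ (chartAt F b) (π ((chartAt E x).symm y)) :=
    contMDiffAt_of_mem_maximalAtlas (IsManifold.chart_mem_maximalAtlas b) hy.2
  exact (h2.comp y ((hπ _).comp y h1)).contDiffAt

theorem fderiv_mapInChart (hπ : ContMDiff 𝓘(ℝ, E) 𝓘(ℝ, F) ∞ π) {x : X} {b : B} {y : E}
    (hy : y ∈ mapInChartDomain (E := E) (F := F) π x b) :
    fderiv ℝ (mapInChart π x b : E → F) y =
      (mfderiv 𝓘(ℝ, F) 𝓘(ℝ, F) (chartAt F b) (π ((chartAt E x).symm y))) ∘L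
      ((mfderiv 𝓘(ℝ, E) 𝓘(ℝ, F) π ((chartAt E x).symm y)) ∘L
      (mfderiv 𝓘(ℝ, E) 𝓘(ℝ, E) (chartAt E x).symm y)) := by
  have h1 := ((mdifferentiable_chartAt x).mdifferentiableAt_symm hy.1).hasMFDerivAt
  have h2 := ((mdifferentiable_chartAt b).mdifferentiableAt hy.2).hasMFDerivAt
  have h3 := ((hπ ((chartAt E x).symm y)).mdifferentiableAt (by simp)).hasMFDerivAt
  rw [← mfderiv_eq_fderiv]
  exact (HasMFDerivAt.comp y h2 (HasMFDerivAt.comp y h3 h1)).mfderiv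

theorem mfderiv_chartAt_injective (b : B) {z : B} (hz : z ∈ (chartAt F b).source) :
    Function.Injective (mfderiv 𝓘(ℝ, F) 𝓘(ℝ, F) (chartAt F b) z) :=
  (mdifferentiable_chartAt b).mfderiv_injective hz

theorem pullback_inChart (hπ : ContMDiff 𝓘(ℝ, E) 𝓘(ℝ, F) ∞ π) (η : TwoForm F B) {x : X} {b : B}
    {y : E} (hy : y ∈ mapInChartDomain (E := E) (F := F) π x b) :
    (pullback π η : TwoForm E X).inChart (chartAt E x) y =
      (η.inChart (chartAt F b) (mapInChart π x b y)).compContinuousLinearMap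
        (fderiv ℝ (mapInChart π x b : E → F) y) := by
  apply ext_form
  intro u v
  have hz := (chartAt F b).map_source hy.2
  have hinv : (chartAt F b).symm (mapInChart π x b y) = π ((chartAt E x).symm y) :=
    (chartAt F b).left_inv hy.2
  rw [fderiv_mapInChart hπ hy]
  have key : ∀ w : TangentSpace 𝓘(ℝ, F) (π ((chartAt E x).symm y)),
      (mfderiv 𝓘(ℝ, F) 𝓘(ℝ, F) (chartAt F b).symm (mapInChart π x b y))
        (mfderiv 𝓘(ℝ, F) 𝓘(ℝ, F) (chartAt F b) (π ((chartAt E x).symm y)) w) = (w : F) := fun w =>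
    congrArg (fun f : F →L[ℝ] F => f w) ((mdifferentiable_chartAt b).symm_comp_deriv hy.2)
  -- The two base points in `hinv` are equal but not by definition; every tangent space is the type
  -- `F`, so the vectors carry over unchanged.
  have hη : ∀ (c c' : B), c = c' → ∀ a a' : F, (η c) ![a, a'] = (η c') ![a, a'] := by
    rintro c _ rfl a a'; rfl
  let A : E →L[ℝ] F := (mfderiv 𝓘(ℝ, E) 𝓘(ℝ, F) π ((chartAt E x).symm y)) ∘L
      (mfderiv 𝓘(ℝ, E) 𝓘(ℝ, E) (chartAt E x).symm y)
  have hl : (pullback π η : TwoForm E X).inChart (chartAt E x) y ![u, v] =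
      (η (π ((chartAt E x).symm y))) ![A u, A v] :=
    (compContinuousLinearMap_apply_pair _ _ _ _).trans
      (compContinuousLinearMap_apply_pair _ _ _ _)
  refine (hl.trans (hη _ _ hinv.symm _ _)).trans (Eq.trans ?_
    ((compContinuousLinearMap_apply_pair _ _ _ _).trans
      (compContinuousLinearMap_apply_pair _ _ _ _)).symm)
  exact congrArg₂ (fun a a' : F => (η ((chartAt F b).symm (mapInChart π x b y))) ![a, a'])
    (key (A u)).symm (key (A v)).symm

theorem eventually_pullback_inChart (hπ : ContMDiff 𝓘(ℝ, E) 𝓘(ℝ, F) ∞ π) (η : TwoForm F B) {x : X}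
    {b : B} {y : E} (hy : y ∈ mapInChartDomain (E := E) (F := F) π x b) :
    (pullback π η : TwoForm E X).inChart (chartAt E x) =ᶠ[𝓝 y] fun y =>
      (η.inChart (chartAt F b) (mapInChart π x b y)).compContinuousLinearMap
        (fderiv ℝ (mapInChart π x b : E → F) y) := by
  filter_upwards [(isOpen_mapInChartDomain hπ.continuous x b).mem_nhds hy] with z hz
  exact pullback_inChart hπ η hz

omit [NormedSpace ℂ E] [NormedSpace ℂ F] [IsManifold 𝓘(ℝ, E) ∞ X] [IsManifold 𝓘(ℝ, F) ∞ B] in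
theorem mem_mapInChartDomain (π : X → B) {x : X} {y : E} (hy : y ∈ (chartAt E x).target) :
    y ∈ mapInChartDomain (F := F) π x (π ((chartAt E x).symm y)) :=
  ⟨hy, mem_chart_source F (π ((chartAt E x).symm y))⟩

theorem isSmooth_pullback [FiniteDimensional ℂ E] (hπ : ContMDiff 𝓘(ℝ, E) 𝓘(ℝ, F) ∞ π)
    {η : TwoForm F B} (hη : η.IsSmooth) : (pullback π η : TwoForm E X).IsSmooth := by
  intro x y hy
  have hy' := mem_mapInChartDomain (F := F) π hy
  refine ContDiffAt.contDiffWithinAt (ContDiffAt.congr_of_eventuallyEq ?_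
    (eventually_pullback_inChart hπ η hy'))
  exact contDiffAt_pullback_form (hη.contDiffAt _ ((chartAt F _).map_source hy'.2))
    (contDiffAt_mapInChart hπ hy')

theorem isClosed_pullback (hπ : ContMDiff 𝓘(ℝ, E) 𝓘(ℝ, F) ∞ π)
    {η : TwoForm F B} (hη : η.IsSmooth) (hd : η.IsClosed) :
    (pullback π η : TwoForm E X).IsClosed := by
  intro x y hy
  have hy' := mem_mapInChartDomain (F := F) π hy
  have hz := (chartAt F _).map_source hy'.2
  have hη' : DifferentiableAt ℝ (η.inChart (chartAt F (π ((chartAt E x).symm y))))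
      (mapInChart π x (π ((chartAt E x).symm y)) y) :=
    (hη.contDiffAt _ hz).differentiableAt (by simp)
  have hdη : extDeriv (η.inChart (chartAt F (π ((chartAt E x).symm y))))
      (mapInChart π x (π ((chartAt E x).symm y)) y) = 0 := hd _ _ hz
  rw [(eventually_pullback_inChart hπ η hy').extDeriv_eq,
    extDeriv_pullback hη' (contDiffAt_mapInChart hπ hy')
      (by rw [minSmoothness_of_isRCLikeNormedField]; exact WithTop.coe_le_coe.2 le_top), hdη]
  ext v; rfl

theorem isSmooth_deformedForm [FiniteDimensional ℂ E] (hπ : ContMDiff 𝓘(ℝ, E) 𝓘(ℝ, F) ∞ π)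
    {Ω : TwoForm E X} (hΩ : Ω.IsSmooth) {η : TwoForm F B} (hη : η.IsSmooth) (t : ℂ) :
    (deformedForm Ω π η t).IsSmooth := fun x =>
  (hΩ x).add ((isSmooth_pullback hπ hη x).const_smul t)

theorem isClosed_deformedForm [FiniteDimensional ℂ E] (hπ : ContMDiff 𝓘(ℝ, E) 𝓘(ℝ, F) ∞ π)
    {Ω : TwoForm E X} (hΩ : Ω.IsSmooth) (hΩd : Ω.IsClosed) {η : TwoForm F B} (hη : η.IsSmooth)
    (hηd : η.IsClosed) (t : ℂ) : (deformedForm Ω π η t).IsClosed := by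
  intro x y hy
  have h1 := (hΩ.contDiffAt x hy).differentiableAt (by simp)
  have h2 := ((isSmooth_pullback hπ hη).contDiffAt x hy).differentiableAt (by simp)
  have h3 : (deformedForm Ω π η t).inChart (chartAt E x) =
    Ω.inChart (chartAt E x) + t • (pullback π η : TwoForm E X).inChart (chartAt E x) := rfl
  rw [h3, extDeriv_add h1 (h2.const_smul t), hΩd x y hy, zero_add]
  ext v
  -- The scalar `t` is complex while the exterior derivative is taken over the reals, so `t` is
  -- pulled out after evaluating on three vectors.
  rw [show v = ![v 0, v 1, v 2] by ext i; fin_cases i <;> rfl,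
    extDeriv_form_apply (h2.const_smul t), fderiv_const_smul h2]
  have h4 := extDeriv_form_apply h2 (v 0) (v 1) (v 2)
  rw [isClosed_pullback hπ hη hηd x y hy] at h4
  change 0 = _ at h4
  change t * _ - t * _ + t * _ = 0
  linear_combination -t * h4

end Charts

/-! ### Fibers of a Lagrangian fibration and the kernel of its differential -/

section Fibration

open Filter Topology

variable {E : Type*} [NormedAddCommGroup E] [NormedSpace ℂ E]
  {X : Type*} [TopologicalSpace X] [ChartedSpace E X] [IsManifold 𝓘(ℝ, E) ∞ X]
  {F : Type*} [NormedAddCommGroup F] [NormedSpace ℂ F]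
  {B : Type*} [TopologicalSpace B] [ChartedSpace F B] [IsManifold 𝓘(ℝ, F) ∞ B]
  {π : X → B}

theorem trans_mem_maximalAtlas (x : X) {φ : OpenPartialHomeomorph E E}
    (h : ContDiffOn ℝ ∞ φ φ.source) (h' : ContDiffOn ℝ ∞ φ.symm φ.target) :
    chartAt E x ≫ₕ φ ∈ IsManifold.maximalAtlas 𝓘(ℝ, E) ∞ X := by
  have hφ : φ ∈ contDiffGroupoid ∞ 𝓘(ℝ, E) :=
    mem_groupoid_of_pregroupoid.2 ⟨h.mono (fun _ hx => hx.1), h'.mono (fun _ hx => hx.1)⟩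
  have hx : chartAt E x ∈ atlas E X := chart_mem_atlas E x
  intro e' he'
  have h1 := (contDiffGroupoid ∞ 𝓘(ℝ, E)).compatible hx he'
  have h2 := (contDiffGroupoid ∞ 𝓘(ℝ, E)).compatible he' hx
  rw [OpenPartialHomeomorph.trans_symm_eq_symm_trans_symm, OpenPartialHomeomorph.trans_assoc,
    ← OpenPartialHomeomorph.trans_assoc e'.symm]
  exact ⟨(contDiffGroupoid ∞ 𝓘(ℝ, E)).trans ((contDiffGroupoid ∞ 𝓘(ℝ, E)).symm hφ) h1,
    (contDiffGroupoid ∞ 𝓘(ℝ, E)).trans h2 hφ⟩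

theorem ker_fderiv_mapInChart (hπ : ContMDiff 𝓘(ℝ, E) 𝓘(ℝ, F) ∞ π) {x : X} {b : B} {y : E}
    (hy : y ∈ mapInChartDomain (E := E) (F := F) π x b) (v : E) :
    fderiv ℝ (mapInChart π x b : E → F) y v = 0 ↔
      mfderiv 𝓘(ℝ, E) 𝓘(ℝ, F) π ((chartAt E x).symm y)
        (mfderiv 𝓘(ℝ, E) 𝓘(ℝ, E) (chartAt E x).symm y v) = 0 := by
  rw [fderiv_mapInChart hπ hy]
  exact map_eq_zero_iff _ (mfderiv_chartAt_injective b hy.2)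

/-- Near a point at which the rank of `dπ` is locally constant, the fiber is a submanifold. -/
theorem exists_isSmoothPoint_of_constant_rank [FiniteDimensional ℂ E] [FiniteDimensional ℂ F]
    (hπ : ContMDiff 𝓘(ℝ, E) 𝓘(ℝ, F) ∞ π) {x : X} {b : B} {y : E}
    (hy : y ∈ mapInChartDomain (E := E) (F := F) π x b)
    (hr : ∀ᶠ z in 𝓝 y, Module.finrank ℝ (fderiv ℝ (mapInChart π x b : E → F) z).toLinearMap.ker =
      Module.finrank ℝ (fderiv ℝ (mapInChart π x b : E → F) y).toLinearMap.ker) :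
    ∃ T : Submodule ℝ (TangentSpace 𝓘(ℝ, E) ((chartAt E x).symm y)),
      IsSmoothPoint (π ⁻¹' {π ((chartAt E x).symm y)}) ((chartAt E x).symm y) T ∧
      ∀ v, v ∈ T ↔ mfderiv 𝓘(ℝ, E) 𝓘(ℝ, F) π ((chartAt E x).symm y) v = 0 := by
  have hs := (isOpen_mapInChartDomain (E := E) (F := F) hπ.continuous x b).mem_nhds hy
  obtain ⟨φ, hyφ, hφs, hφ, hφ', hder, hiff⟩ := exists_straightening hs
    (fun z hz => (contDiffAt_mapInChart hπ hz).contDiffWithinAt) hr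
  set e := chartAt E x
  have hye : e (e.symm y) = y := e.right_inv hy.1
  -- The straightening has derivative 1 at `y`, so the composite chart has the derivative of `e` and
  -- the tangent space of the fiber is exactly the kernel of dπ.
  have hmf : ∀ v, mfderiv 𝓘(ℝ, E) 𝓘(ℝ, E) (e ≫ₕ φ) (e.symm y) v =
      mfderiv 𝓘(ℝ, E) 𝓘(ℝ, E) e (e.symm y) v := by
    intro v
    have h1 : HasMFDerivAt 𝓘(ℝ, E) 𝓘(ℝ, E) φ (e (e.symm y)) (ContinuousLinearMap.id ℝ E) := by
      rw [hye]; exact hder.hasMFDerivAt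
    have h2 := ((mdifferentiable_chartAt x).mdifferentiableAt (e.map_target hy.1)).hasMFDerivAt
    have h3 := (HasMFDerivAt.comp (e.symm y) h1 h2).mfderiv
    exact congrArg (fun f : E →L[ℝ] E => f v) h3
  refine ⟨_, ⟨e ≫ₕ φ, trans_mem_maximalAtlas x hφ hφ', ?_,
    (fderiv ℝ (mapInChart π x b : E → F) y).toLinearMap.ker, ?_, rfl⟩, ?_⟩
  · rw [OpenPartialHomeomorph.trans_source]
    exact ⟨e.map_target hy.1, by rw [Set.mem_preimage, hye]; exact hyφ⟩
  · intro z hz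
    rw [OpenPartialHomeomorph.trans_source] at hz
    have h1 := hiff (e z) hz.2
    have hzs := hφs hz.2
    have hez : e.symm (e z) = z := e.left_inv hz.1
    rw [OpenPartialHomeomorph.coe_trans, Function.comp_apply, Function.comp_apply, hye, ← h1]
    have hzb := hzs.2
    rw [Set.mem_preimage, hez] at hzb
    simp only [mapInChart]
    rw [hez, (chartAt F b).injOn.eq_iff hzb hy.2]
    rfl
  · intro v
    have h1 := ker_fderiv_mapInChart hπ hy (mfderiv 𝓘(ℝ, E) 𝓘(ℝ, E) e (e.symm y) v)
    rw [mfderiv_symm_chart_apply x hy.1] at h1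
    rw [← h1]
    exact iff_of_eq (congrArg (fun w : E => fderiv ℝ (mapInChart π x b : E → F) y w = 0) (hmf v))

omit [IsManifold 𝓘(ℝ, E) ∞ X] [IsManifold 𝓘(ℝ, F) ∞ B] in
/-- The tangent spaces of the fibers are contained in the kernel of `dπ`. -/
theorem mfderiv_eq_zero_of_isSmoothPoint (hπ : ContMDiff 𝓘(ℝ, E) 𝓘(ℝ, F) ∞ π) {b : B} {x : X}
    {T : Submodule ℝ (TangentSpace 𝓘(ℝ, E) x)} (hT : IsSmoothPoint (π ⁻¹' {b}) x T)
    {v : TangentSpace 𝓘(ℝ, E) x} (hv : v ∈ T) : mfderiv 𝓘(ℝ, E) 𝓘(ℝ, F) π x v = 0 := by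
  obtain ⟨φ, hφ, hx, W, hW, rfl⟩ := hT
  set w : E := mfderiv 𝓘(ℝ, E) 𝓘(ℝ, E) φ x v with hw
  have hwW : w ∈ W := hv
  -- A line inside the straightened fiber; `π ∘ φ.symm` is constant along it near 0, so its
  -- derivative along `w` is zero.
  let c : ℝ → E := fun r => φ x + r • w
  have hc0 : c 0 = φ x := by simp [c]
  have hcder : HasMFDerivAt 𝓘(ℝ, ℝ) 𝓘(ℝ, E) c 0 (ContinuousLinearMap.toSpanSingleton ℝ w) := by
    have h1 := ((hasDerivAt_id (0 : ℝ)).smul_const w).const_add (φ x)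
    rw [one_smul] at h1
    exact h1.hasFDerivAt.hasMFDerivAt
  have hφd : MDifferentiableAt 𝓘(ℝ, E) 𝓘(ℝ, E) φ x :=
    (contMDiffAt_of_mem_maximalAtlas hφ hx).mdifferentiableAt (by simp)
  have hφs : MDifferentiableAt 𝓘(ℝ, E) 𝓘(ℝ, E) φ.symm (φ x) :=
    (contMDiffAt_symm_of_mem_maximalAtlas hφ (φ.map_source hx)).mdifferentiableAt (by simp)
  have hπd : MDifferentiableAt 𝓘(ℝ, E) 𝓘(ℝ, F) π x := (hπ x).mdifferentiableAt (by simp)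
  -- `π ∘ φ.symm` is differentiable with derivative `dπ ∘ dφ⁻¹`
  have hcomp : (mfderiv 𝓘(ℝ, E) 𝓘(ℝ, F) (π ∘ φ.symm) (φ x)) w =
      mfderiv 𝓘(ℝ, E) 𝓘(ℝ, F) π x v := by
    have hd : MDifferentiableAt 𝓘(ℝ, E) 𝓘(ℝ, F) (π ∘ φ.symm) (φ x) :=
      ((hπ _).mdifferentiableAt (by simp)).comp _ hφs
    have h1 := (HasMFDerivAt.comp x hd.hasMFDerivAt hφd.hasMFDerivAt)
    have h2 : π =ᶠ[𝓝 x] (π ∘ φ.symm) ∘ φ := by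
      filter_upwards [φ.open_source.mem_nhds hx] with z hz
      simp only [Function.comp_apply, φ.left_inv hz]
    have h3 := (h1.congr_of_eventuallyEq h2).mfderiv
    exact (congrArg (fun f : E →L[ℝ] F => f v) h3).symm
  rw [← hcomp]
  have hd : HasMFDerivAt 𝓘(ℝ, E) 𝓘(ℝ, F) (π ∘ φ.symm) (c 0)
      (mfderiv 𝓘(ℝ, E) 𝓘(ℝ, F) (π ∘ φ.symm) (φ x)) := by
    rw [hc0]
    exact (((hπ _).mdifferentiableAt (by simp)).comp _ hφs).hasMFDerivAt
  have h4 := HasMFDerivAt.comp (0 : ℝ) hd hcder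
  have h5 : (fun _ : ℝ => b) =ᶠ[𝓝 0] (π ∘ φ.symm) ∘ c := by
    have hcont : ContinuousAt c 0 := hcder.continuousAt
    have hmem : φ.target ∈ 𝓝 (c 0) := by
      rw [hc0]; exact φ.open_target.mem_nhds (φ.map_source hx)
    filter_upwards [hcont.preimage_mem_nhds hmem] with r hr
    have h6 := (hW (φ.symm (c r)) (φ.map_target hr)).2 (by
      rw [φ.right_inv hr, add_sub_cancel_left]
      exact W.smul_mem r hwW)
    exact (show π (φ.symm (c r)) = b from h6).symm
  have h6 := (h4.congr_of_eventuallyEq h5).mfderiv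
  have h7 := congrArg (fun f : ℝ →L[ℝ] F => f 1) h6
  have h8 : mfderiv 𝓘(ℝ, ℝ) 𝓘(ℝ, F) (fun _ : ℝ => b) 0 = 0 := mfderiv_const
  rw [h8] at h7
  change (0 : F) = (mfderiv 𝓘(ℝ, E) 𝓘(ℝ, F) (π ∘ φ.symm) (φ x)) ((1 : ℝ) • w) at h7
  rw [one_smul] at h7
  exact h7.symm

/-- The kernels of the differential of a Lagrangian fibration are coisotropic, also at the singular
points of the fibers. -/
theorem IsLagrangianFibration.isCoisotropicKer [FiniteDimensional ℂ E] [FiniteDimensional ℂ F]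
    {Ω : TwoForm E X} (hΩ : IsHolomorphicSymplectic (stdJ E X) Ω)
    (hπ : IsLagrangianFibration (F := F) (stdJ E X) Ω π) (x : X) :
    IsCoisotropicKer (Ω x) (mfderiv 𝓘(ℝ, E) 𝓘(ℝ, F) π x) := by
  set e := chartAt E x with he
  have hx₀ : e x ∈ e.target := e.map_source (mem_chart_source E x)
  have hex : e.symm (e x) = x := e.left_inv (mem_chart_source E x)
  let b := π (e.symm (e x))
  have hx : e x ∈ mapInChartDomain (F := F) π x b := mem_mapInChartDomain π hx₀
  have hopen := isOpen_mapInChartDomain (E := E) (F := F) hπ.smooth.continuous x b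
  have htrans : ∀ y ∈ mapInChartDomain (E := E) (F := F) π x b,
      (IsCoisotropicKer (Ω.inChart e y) (fderiv ℝ (mapInChart π x b : E → F) y) ↔
        IsCoisotropicKer (Ω (e.symm y)) (mfderiv 𝓘(ℝ, E) 𝓘(ℝ, F) π (e.symm y))) := by
    intro y hy
    rw [fderiv_mapInChart hπ.smooth hy]
    exact isCoisotropicKer_transport (mfderiv_symm_chart_apply x hy.1)
      (mfderiv_chartAt_injective b hy.2)
  have key : IsCoisotropicKer (Ω.inChart e (e x)) (fderiv ℝ (mapInChart π x b : E → F) (e x)) := by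
    refine isCoisotropicKer_of_frequently (K := (stdJ E X).inChart e)
      (hΩ.induced.eventually_inChart x hx₀) (hΩ.smooth.contDiffAt x hx₀).continuousAt
      ((contDiffAt_mapInChart hπ.smooth hx).fderiv_right (m := 0) (by simp)).continuousAt ?_ ?_
    · filter_upwards [hopen.mem_nhds hx] with y hy v hv
      rw [ker_fderiv_mapInChart hπ.smooth hy] at hv ⊢
      have h1 := mfderiv_symm_chart_apply x hy.1
        (stdJ E X (e.symm y) (mfderiv 𝓘(ℝ, E) 𝓘(ℝ, E) e.symm y v))
      refine (congrArg (mfderiv 𝓘(ℝ, E) 𝓘(ℝ, F) π (e.symm y)) h1).trans ?_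
      rw [hπ.holomorphic, hv, map_zero]
    -- Every neighbourhood contains a point of locally constant rank; there the kernel is the
    -- tangent space of the fiber, hence Lagrangian and in particular coisotropic.
    · rw [frequently_nhds_iff]
      intro U hxU hU
      obtain ⟨y, hy, hr⟩ := exists_constant_rank (D := fderiv ℝ (mapInChart π x b : E → F))
        (hU.inter hopen) ⟨e x, hxU, hx⟩ (fun y hy =>
          ((contDiffAt_mapInChart hπ.smooth hy.2).fderiv_right
            (m := 0) (by simp)).continuousAt.continuousWithinAt)
      refine ⟨y, hy.1, (htrans y hy.2).2 ?_⟩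
      obtain ⟨T, hT, hTker⟩ := exists_isSmoothPoint_of_constant_rank hπ.smooth hy.2 hr
      have hL := hπ.lagrangian _ _ _ hT
      intro u hu
      rw [← hTker]
      exact hL.mem_of_forall fun v hv => hu v ((hTker v).1 hv)
  have := (htrans _ hx).1 key
  rwa [hex] at this

-- Since dπ is complex linear, it sends (0,1)-vectors to (0,1)-vectors.
omit [IsManifold 𝓘(ℝ, E) ∞ X] [IsManifold 𝓘(ℝ, F) ∞ B] in
theorem isType20Add11At_pullback {η : TwoForm F B}
    (hη : ∀ b, IsType20Add11At (stdJ F B b) (η b)) {x : X}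
    (hπ : ∀ v : TangentSpace 𝓘(ℝ, E) x, mfderiv 𝓘(ℝ, E) 𝓘(ℝ, F) π x (stdJ E X x v) =
      stdJ F B (π x) (mfderiv 𝓘(ℝ, E) 𝓘(ℝ, F) π x v)) (t : ℂ) :
    IsType20Add11At (stdJ E X x) (t • (pullback π η : TwoForm E X) x) := by
  intro u v
  have h := hη (π x) (mfderiv 𝓘(ℝ, E) 𝓘(ℝ, F) π x u) (mfderiv 𝓘(ℝ, E) 𝓘(ℝ, F) π x v)
  rw [complexify] at h ⊢
  have hp : ∀ a c : TangentSpace 𝓘(ℝ, E) x, (t • (pullback π η : TwoForm E X) x) ![a, c] =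
      t * η (π x) ![mfderiv 𝓘(ℝ, E) 𝓘(ℝ, F) π x a, mfderiv 𝓘(ℝ, E) 𝓘(ℝ, F) π x c] := fun a c =>
    congrArg (fun z => t * z) (compContinuousLinearMap_apply_pair _ _ _ _)
  rw [hp, hp, hp, hp, hπ, hπ]
  linear_combination t * h

end Fibration

end CSymp

end

/-! ### The main theorem -/

theorem mainTheorem2
    {E : Type*} [NormedAddCommGroup E] [NormedSpace ℂ E] [FiniteDimensional ℂ E]
    {X : Type*} [TopologicalSpace X] [ChartedSpace E X] [IsManifold 𝓘(ℂ, E) ω X]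
    {F : Type*} [NormedAddCommGroup F] [NormedSpace ℂ F] [FiniteDimensional ℂ F]
    {B : Type*} [TopologicalSpace B] [ChartedSpace F B] [IsManifold 𝓘(ℂ, F) ω B]
    (n : ℕ) (hn : Module.finrank ℂ E = 2 * n)
    (Ω : CSymp.TwoForm E X) (hΩ : CSymp.IsHolomorphicSymplectic (CSymp.stdJ E X) Ω)
    (π : X → B) (hπ : CSymp.IsLagrangianFibration (F := F) (CSymp.stdJ E X) Ω π)
    (η : CSymp.TwoForm F B) (hη_smooth : CSymp.TwoForm.IsSmooth η) (hη_closed : CSymp.TwoForm.IsClosed η)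
    (hη_type : ∀ b, CSymp.IsType20Add11At (CSymp.stdJ F B b) (η b)) (t : ℂ) :
    -- the form `Ω_t` is c-symplectic
    CSymp.IsCSymplectic n (CSymp.deformedForm Ω π η t) ∧
    -- it induces a unique almost complex structure `J = I_t`
    (∃! J : CSymp.EndField E X, CSymp.IsInduced (CSymp.deformedForm Ω π η t) J) ∧
    ∀ J : CSymp.EndField E X, CSymp.IsInduced (CSymp.deformedForm Ω π η t) J →
      -- which is smooth and integrable
      CSymp.EndField.IsSmooth J ∧ CSymp.EndField.IsIntegrable J ∧
      -- `π` is a Lagrangian fibration on the deformed manifold, over the same complex manifold `B`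
      CSymp.IsLagrangianFibration (F := F) J (CSymp.deformedForm Ω π η t) π ∧
      -- the complex structure on the fibers is unchanged
      (∀ (b : B) (x : X) (T : Submodule ℝ (TangentSpace 𝓘(ℝ, E) x)),
        CSymp.IsSmoothPoint (π ⁻¹' {b}) x T → ∀ v ∈ T, J x v ∈ T ∧ J x v = CSymp.stdJ E X x v) ∧
      (∀ (x : X) (v : TangentSpace 𝓘(ℝ, E) x), mfderiv 𝓘(ℝ, E) 𝓘(ℝ, F) π x v = 0 →
        J x v = CSymp.stdJ E X x v) := by
  have : IsManifold 𝓘(ℝ, E) ∞ X := CSymp.isManifold_real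
  have : IsManifold 𝓘(ℝ, F) ∞ B := CSymp.isManifold_real
  have hfd : ∀ x : X, FiniteDimensional ℝ (TangentSpace 𝓘(ℝ, E) x) := fun _ =>
    inferInstanceAs (FiniteDimensional ℝ E)
  have ht2 : ∀ x : X, T2Space (TangentSpace 𝓘(ℝ, E) x) := fun _ => inferInstanceAs (T2Space E)
  have hrank : ∀ x : X, Module.finrank ℝ (TangentSpace 𝓘(ℝ, E) x) = 4 * n := fun _ => by
    change Module.finrank ℝ E = _
    rw [← Module.finrank_mul_finrank ℝ ℂ E, Complex.finrank_real_complex, hn]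
    ring
  -- the deformed complex structure
  have hα0 : ∀ (x : X) (u v : TangentSpace 𝓘(ℝ, E) x), mfderiv 𝓘(ℝ, E) 𝓘(ℝ, F) π x u = 0 →
      (t • (CSymp.pullback π η : CSymp.TwoForm E X) x) ![u, v] = 0 := by
    intro x u v hu
    have h1 : (CSymp.pullback π η : CSymp.TwoForm E X) x ![u, v] = 0 := by
      refine (CSymp.compContinuousLinearMap_apply_pair _ _ _ _).trans ?_
      rw [hu]
      exact CSymp.form_zero_left _ _
    exact (congrArg (fun z => t * z) h1).trans (mul_zero t)
  have hex : ∀ x : X, ∃ J : TangentSpace 𝓘(ℝ, E) x →L[ℝ] TangentSpace 𝓘(ℝ, E) x,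
      CSymp.IsInducedAt (CSymp.deformedForm Ω π η t x) J ∧
      (∀ u, mfderiv 𝓘(ℝ, E) 𝓘(ℝ, F) π x (J u) =
        mfderiv 𝓘(ℝ, E) 𝓘(ℝ, F) π x (CSymp.stdJ E X x u)) ∧
      ∀ u, mfderiv 𝓘(ℝ, E) 𝓘(ℝ, F) π x u = 0 → J u = CSymp.stdJ E X x u := fun x =>
    (hΩ.induced x).exists_deformation
      (CSymp.isType20Add11At_pullback hη_type (hπ.holomorphic x) t)
      (hπ.isCoisotropicKer hΩ x) (hα0 x)
      (fun u hu => by rw [hπ.holomorphic, hu, map_zero])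
  -- The choice is made point by point with no regularity; smoothness follows afterwards, because
  -- the form determines the operator.
  choose J₀ hJ₀ hJ₀π hJ₀ker using hex
  have huniq : ∀ J : CSymp.EndField E X,
      CSymp.IsInduced (CSymp.deformedForm Ω π η t) J → J = J₀ := fun J hJ =>
    funext fun x => (hJ x).unique (hJ₀ x)
  have hsmooth := CSymp.isSmooth_deformedForm hπ.smooth hΩ.smooth hη_smooth t
  have hclosed := CSymp.isClosed_deformedForm hπ.smooth hΩ.smooth hΩ.closed hη_smooth hη_closed t
  refine ⟨⟨hsmooth, hclosed, fun x => (hJ₀ x).isCSymplecticAt n (hrank x)⟩,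
    ⟨J₀, hJ₀, huniq⟩, fun J hJ => ?_⟩
  obtain rfl := huniq J hJ
  refine ⟨hJ.isSmooth hsmooth, hJ.isIntegrable hsmooth hclosed, ⟨hπ.smooth, fun x v => ?_,
    fun b x T hT => ?_⟩, fun b x T hT v hv => ?_, hJ₀ker⟩
  · rw [hJ₀π, hπ.holomorphic]
  -- Only the inclusion of `T` in the kernel of dπ is needed; on a multiple fiber it can be strict.
  · exact (hπ.lagrangian b x T hT).add_of_le_ker fun u hu v =>
      hα0 x u v (CSymp.mfderiv_eq_zero_of_isSmoothPoint hπ.smooth hT hu)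
  · have hv' := hJ₀ker x v (CSymp.mfderiv_eq_zero_of_isSmoothPoint hπ.smooth hT hv)
    rw [hv']
    exact ⟨(hΩ.induced x).mem_of_isCLagrangian (hπ.lagrangian b x T hT) hv, rfl⟩
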